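/- Let $k$ be a commutative $\mathbb{Q}$-algebra (an ordinary ring, i.e. discrete, with no grading or differential). Let $\mathsf{C}(k)$ be the category of unbounded cochain complexes of $k$-modules (indexed by $\mathbb{Z}$, differential of degree $+1$). A \emph{dg-Lie algebra} over $k$ is an object $\mathfrak{g}$ of $\mathsf{C}(k)$ with a morphism of complexes $[-,-]:\mathfrak{g}\otimes_k\mathfrak{g}\to\mathfrak{g}$ such that, for all homogeneous $x,y,z\in\mathfrak{g}$, \begin{enumerate} \item $[x,y]=(-1)^{|x||y|+1}[y,x]$, \item $[x,[y,z]]+(-1)^{|z||x|+|x||y|}[y,[z,x]]+(-1)^{|z||x|+|z||y|}[z,[x,y]]=0$. \end{enumerate} (That the bracket is a morphism of complexes means that $d[x,y]=[dx,y]+(-1)^{|x|}[x,dy]$.) Morphisms of dg-Lie algebras are the morphisms of complexes commuting with the brackets; let $\mathsf{dgLieAlg}_k$ be the resulting category. Then there is a (closed) model category structure on $\mathsf{dgLieAlg}_k$ in which a morphism $f$ is a weak equivalence if and only if the underlying morphism of $\mathsf{C}(k)$ is a quasi-isomorphism, and $f$ is a fibration if and only if the underlying morphism of $\mathsf{C}(k)$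 is surjective in every degree. -/

import Mathlib

open CategoryTheory HomotopicalAlgebra

universe u

/-- An (unbounded, cohomologically graded) dg-Lie algebra over `k`: a cochain complex of
`k`-modules indexed by `ℤ`, with differential of degree `+1`, together with a `k`-bilinear
bracket of degree `0`. A morphism of complexes `L ⊗ L ⟶ L` is the same thing as a family of
`k`-bilinear maps `L^p × L^q → L^n`, for `p + q = n`, which satisfies the Leibniz rule.

The bracket takes the total degree `n` as an argument, with a proof of `p + q = n`, so that
elements of `L^(p + q)` and of `L^(q + p)` can be compared without casts. -/
structure DGLieAlgebra (k : Type u) [CommRing k] where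
  /-- the underlying complex of `k`-modules -/
  complex : CochainComplex (ModuleCat.{u} k) ℤ
  /-- the bracket `[x, y]` of `x` of degree `p` and `y` of degree `q` -/
  bracket (p q n : ℤ) (h : p + q = n) :
    complex.X p →ₗ[k] complex.X q →ₗ[k] complex.X n
  /-- graded antisymmetry: `[x, y] = (-1)^(|x||y| + 1) [y, x]` -/
  antisymm (p q n : ℤ) (h : p + q = n) (h' : q + p = n)
    (x : complex.X p) (y : complex.X q) :
    bracket p q n h x y = (p * q + 1).negOnePow • bracket q p n h' y x
  /-- the graded Jacobi identity:
  `[x, [y, z]] + (-1)^(|z||x| + |x||y|) [y, [z, x]] + (-1)^(|z||x| + |z||y|) [z, [x, y]] = 0` -/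
  jacobi (p q r qr rp pq n : ℤ) (hqr : q + r = qr) (hrp : r + p = rp) (hpq : p + q = pq)
    (h₁ : p + qr = n) (h₂ : q + rp = n) (h₃ : r + pq = n)
    (x : complex.X p) (y : complex.X q) (z : complex.X r) :
    bracket p qr n h₁ x (bracket q r qr hqr y z)
      + (r * p + p * q).negOnePow • bracket q rp n h₂ y (bracket r p rp hrp z x)
      + (r * p + r * q).negOnePow • bracket r pq n h₃ z (bracket p q pq hpq x y) = 0
  /-- the Leibniz rule: `d [x, y] = [d x, y] + (-1)^|x| [x, d y]` -/
  leibniz (p p' q q' n n' : ℤ) (hp : p + 1 = p') (hq : q + 1 = q') (hn : n + 1 = n')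
    (h : p + q = n) (h₁ : p' + q = n') (h₂ : p + q' = n')
    (x : complex.X p) (y : complex.X q) :
    (complex.d n n').hom (bracket p q n h x y) =
      bracket p' q n' h₁ ((complex.d p p').hom x) y
        + p.negOnePow • bracket p q' n' h₂ x ((complex.d q q').hom y)

namespace DGLieAlgebra

variable {k : Type u} [CommRing k]

/-- A morphism of dg-Lie algebras: a morphism of complexes which commutes with the brackets. -/
@[ext]
structure Hom (L M : DGLieAlgebra k) where
  /-- the underlying morphism of complexes -/
  toHom : L.complex ⟶ M.complex
  map_bracket (p q n : ℤ) (h : p + q = n) (x : L.complex.X p) (y : L.complex.X q) :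
    (toHom.f n).hom (L.bracket p q n h x y) =
      M.bracket p q n h ((toHom.f p).hom x) ((toHom.f q).hom y)

/-- The category of unbounded dg-Lie algebras over `k`. -/
instance : Category (DGLieAlgebra k) where
  Hom := Hom
  id L :=
    { toHom := 𝟙 L.complex
      map_bracket := fun _ _ _ _ _ _ => rfl }
  comp f g :=
    { toHom := f.toHom ≫ g.toHom
      map_bracket := fun p q n h x y => by
        simp [f.map_bracket, g.map_bracket] }

variable (k) in
/-- The forgetful functor from dg-Lie algebras over `k` to the category of unbounded
complexes of `k`-modules. -/
def forgetToComplex : DGLieAlgebra k ⥤ CochainComplex (ModuleCat.{u} k) ℤ where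
  obj L := L.complex
  map f := f.toHom

end DGLieAlgebra

/-! Cofibrations are defined by the left lifting property against surjective quasi-isomorphisms. The
latter are the maps satisfying `IsAcyclicFibration`, an elementwise condition: a cocycle `x` of the
source and an element `y` of the target with `f x = d y` come from a single `z` with `d z = x` and
`f z = y`. What remains is finite limits and colimits, two factorizations, and the lifting of
trivial cofibrations against surjections.

Colimits and both factorizations come from one construction, `presented`: the dg-Lie algebra
generated by a diagram and by new generators `cell t l` with differential `t`, where `t` is a
cocycle that may itself involve new generators. Allowing this nesting in an inductive type of
expressions replaces the transfinite iteration of the small object argument. Its universal property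
`presented.lift` is evaluation of expressions, with lifting along a map `p` built in.

For `f : A ⟶ B`, adding a generator for every cocycle `t` and every `b` with `f(t) = d b` gives a
cofibration followed by an acyclic fibration (`semifree`).

For the other factorization, free pairs `x_s, d x_s` are added to `A`, one for each element of `B`.
The extension lifts against surjections because the image of `x_s` is arbitrary. That it is a
quasi-isomorphism is where `ℚ` matters (`quasiIso_of_weightVectors`). The derivation `h` with `h(d
x_s) = x_s`, zero on `A` and on the `x_s`, makes `d h + h d` a derivation of degree 0 that is zero
on `A` and the identity on the new generators. Everything is then a sum of elements of `A` and of
eigenvectors of positive integer weight. On cocycles the operator takes coboundary values, so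
inverting the weights pushes every cocycle into `A` up to coboundary.

The last lifting property follows by the retract argument. -/

namespace ModuleCat

/-! ### Homology of complexes of modules in terms of elements -/

variable {k : Type u} [CommRing k] {S T : ShortComplex (ModuleCat.{u} k)}

/-- The homology class of a cycle in a short complex of modules. -/
noncomputable def homologyClass (S : ShortComplex (ModuleCat.{u} k)) (x : S.X₂) (hx : S.g x = 0) :
    S.homology :=
  S.homologyπ (S.moduleCatCyclesIso.inv (⟨x, hx⟩ : LinearMap.ker S.g.hom))

theorem iCycles_moduleCatCyclesIso_inv (x : S.X₂) (hx : S.g x = 0) :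
    S.iCycles (S.moduleCatCyclesIso.inv (⟨x, hx⟩ : LinearMap.ker S.g.hom)) = x :=
  S.moduleCatCyclesIso_inv_iCycles_apply _

/-- Homology embeds in the opcycles, where the class of `x` no longer involves the proof that `x` is
a cycle; equalities of classes are tested there. -/
theorem homologyι_homologyClass (x : S.X₂) (hx : S.g x = 0) :
    S.homologyι (homologyClass S x hx) = S.pOpcycles x := by
  have h := ConcreteCategory.congr_hom S.homology_π_ι
    (S.moduleCatCyclesIso.inv (⟨x, hx⟩ : LinearMap.ker S.g.hom))
  rw [ConcreteCategory.comp_apply, ConcreteCategory.comp_apply,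
    iCycles_moduleCatCyclesIso_inv] at h
  exact h

theorem homologyι_injective : Function.Injective S.homologyι :=
  (ModuleCat.mono_iff_injective _).1 inferInstance

theorem homologyClass_surjective (c : S.homology) :
    ∃ x hx, homologyClass S x hx = c := by
  obtain ⟨z, rfl⟩ := (ModuleCat.epi_iff_surjective S.homologyπ).1 inferInstance c
  obtain ⟨⟨x, hx⟩, rfl⟩ :=
    (ModuleCat.epi_iff_surjective S.moduleCatCyclesIso.inv).1 inferInstance z
  exact ⟨x, hx, rfl⟩

theorem homologyMap_homologyClass (φ : S ⟶ T) (x : S.X₂) (hx : S.g x = 0)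
    (hx' : T.g (φ.τ₂ x) = 0) :
    ShortComplex.homologyMap φ (homologyClass S x hx) = homologyClass T (φ.τ₂ x) hx' := by
  apply homologyι_injective
  rw [homologyι_homologyClass]
  have h := ConcreteCategory.congr_hom (ShortComplex.homologyι_naturality φ)
    (homologyClass S x hx)
  rw [ConcreteCategory.comp_apply, ConcreteCategory.comp_apply, homologyι_homologyClass] at h
  rw [h]
  have h' := ConcreteCategory.congr_hom (ShortComplex.p_opcyclesMap φ) x
  rwa [ConcreteCategory.comp_apply, ConcreteCategory.comp_apply] at h'

theorem homologyClass_eq_iff (x y : S.X₂) (hx : S.g x = 0) (hy : S.g y = 0) :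
    homologyClass S x hx = homologyClass S y hy ↔ ∃ z, S.f z = x - y := by
  rw [← homologyι_injective.eq_iff, homologyι_homologyClass, homologyι_homologyClass,
    S.moduleCat_pOpcycles_eq_iff]
  rfl

theorem isIso_homologyMap_iff (φ : S ⟶ T) :
    IsIso (ShortComplex.homologyMap φ) ↔
      (∀ x : S.X₂, S.g x = 0 → (∃ z, T.f z = φ.τ₂ x) → ∃ z, S.f z = x) ∧
      (∀ y : T.X₂, T.g y = 0 → ∃ x : S.X₂, S.g x = 0 ∧ ∃ z, T.f z = φ.τ₂ x - y) := by
  have hφ : ∀ x : S.X₂, S.g x = 0 → T.g (φ.τ₂ x) = 0 := fun x hx => by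
    have h := ConcreteCategory.congr_hom φ.comm₂₃ x
    rw [ConcreteCategory.comp_apply, ConcreteCategory.comp_apply, hx, map_zero] at h
    exact h
  rw [ConcreteCategory.isIso_iff_bijective]
  constructor
  · intro h
    refine ⟨fun x hx hz => ?_, fun y hy => ?_⟩
    · have h0 : homologyClass S x hx = homologyClass S 0 (map_zero _) := by
        apply h.1
        rw [homologyMap_homologyClass φ x hx (hφ x hx),
          homologyMap_homologyClass φ 0 (map_zero _) (hφ 0 (map_zero _)), homologyClass_eq_iff]
        simpa using hz
      simpa using (homologyClass_eq_iff _ _ _ _).1 h0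
    · obtain ⟨c, hc⟩ := h.2 (homologyClass T y hy)
      obtain ⟨x, hx, rfl⟩ := homologyClass_surjective c
      rw [homologyMap_homologyClass φ x hx (hφ x hx), homologyClass_eq_iff] at hc
      exact ⟨x, hx, hc⟩
  · rintro ⟨h₁, h₂⟩
    refine ⟨(injective_iff_map_eq_zero (ShortComplex.homologyMap φ).hom).2 fun c hc => ?_,
      fun c => ?_⟩
    · obtain ⟨x, hx, rfl⟩ := homologyClass_surjective c
      have hzero : homologyClass S 0 (map_zero _) = 0 := by
        apply homologyι_injective
        rw [homologyι_homologyClass, map_zero, map_zero]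
      have hzero' : homologyClass T 0 (map_zero _) = 0 := by
        apply homologyι_injective
        rw [homologyι_homologyClass, map_zero, map_zero]
      have hc' : homologyClass T (φ.τ₂ x) (hφ x hx) = homologyClass T 0 (map_zero _) := by
        rw [hzero', ← homologyMap_homologyClass φ x hx (hφ x hx)]
        exact hc
      rw [← hzero, homologyClass_eq_iff]
      rw [homologyClass_eq_iff] at hc'
      simpa using h₁ x hx (by simpa using hc')
    · obtain ⟨y, hy, rfl⟩ := homologyClass_surjective c
      obtain ⟨x, hx, hz⟩ := h₂ y hy
      refine ⟨homologyClass S x hx, ?_⟩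
      rw [homologyMap_homologyClass φ x hx (hφ x hx), homologyClass_eq_iff]
      exact hz

end ModuleCat

/-- A map of complexes of modules is a quasi-isomorphism if and only if it detects boundaries
among cocycles and hits every cocycle up to a boundary. -/
theorem CochainComplex.quasiIso_iff_forall {k : Type u} [CommRing k]
    {K L : CochainComplex (ModuleCat.{u} k) ℤ} (φ : K ⟶ L) :
    QuasiIso φ ↔ ∀ n : ℤ,
      (∀ x : K.X (n + 1), (K.d (n + 1) (n + 1 + 1)).hom x = 0 →
        (∃ z, (L.d n (n + 1)).hom z = (φ.f (n + 1)).hom x) →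
          ∃ z, (K.d n (n + 1)).hom z = x) ∧
      (∀ y : L.X (n + 1), (L.d (n + 1) (n + 1 + 1)).hom y = 0 →
        ∃ x, (K.d (n + 1) (n + 1 + 1)).hom x = 0 ∧
          ∃ z, (L.d n (n + 1)).hom z = (φ.f (n + 1)).hom x - y) := by
  have key (n : ℤ) : QuasiIsoAt φ (n + 1) ↔ _ :=
    (quasiIsoAt_iff' φ n (n + 1) (n + 1 + 1) (by simp) (by simp)).trans
      ((ShortComplex.quasiIso_iff _).trans (ModuleCat.isIso_homologyMap_iff _))
  rw [quasiIso_iff]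
  constructor
  · intro h n
    exact (key n).1 (h _)
  · intro h n
    -- The criterion is stated in degree `n + 1` so that no predecessor occurs; every degree has
    -- this form.
    obtain ⟨m, rfl⟩ : ∃ m, m + 1 = n := ⟨n - 1, by ring⟩
    exact (key m).2 (h m)

/-! ### Componentwise description of dg-Lie algebras and their morphisms -/

namespace DGLieAlgebra

variable {k : Type u} [CommRing k]

/-- The differential of a dg-Lie algebra, in degree `n`. -/
abbrev diff (L : DGLieAlgebra k) (n : ℤ) : L.complex.X n →ₗ[k] L.complex.X (n + 1) :=
  (L.complex.d n (n + 1)).hom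

theorem diff_diff (L : DGLieAlgebra k) (n : ℤ) (x : L.complex.X n) :
    L.diff (n + 1) (L.diff n x) = 0 := by
  have h := ConcreteCategory.congr_hom (L.complex.d_comp_d n (n + 1) (n + 1 + 1)) x
  rwa [ConcreteCategory.comp_apply] at h

/-- The components of a morphism of dg-Lie algebras. -/
abbrev Hom.app {L M : DGLieAlgebra k} (f : L ⟶ M) (n : ℤ) :
    L.complex.X n →ₗ[k] M.complex.X n :=
  (Hom.toHom f |>.f n).hom

theorem Hom.app_diff {L M : DGLieAlgebra k} (f : L ⟶ M) (n : ℤ) (x : L.complex.X n) :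
    Hom.app f (n + 1) (L.diff n x) = M.diff n (Hom.app f n x) := by
  have h := ConcreteCategory.congr_hom ((Hom.toHom f).comm n (n + 1)) x
  rw [ConcreteCategory.comp_apply, ConcreteCategory.comp_apply] at h
  exact h.symm

theorem Hom.app_bracket {L M : DGLieAlgebra k} (f : L ⟶ M) {p q n : ℤ} (h : p + q = n)
    (x : L.complex.X p) (y : L.complex.X q) :
    Hom.app f n (L.bracket p q n h x y) = M.bracket p q n h (Hom.app f p x) (Hom.app f q y) :=
  Hom.map_bracket f p q n h x y

theorem hom_ext {L M : DGLieAlgebra k} {f g : L ⟶ M}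
    (h : ∀ n x, Hom.app f n x = Hom.app g n x) : f = g := by
  apply Hom.ext
  ext n x
  exact h n x

/-- A constructor for morphisms of dg-Lie algebras. -/
def homMk {L M : DGLieAlgebra k} (f : ∀ n, L.complex.X n →ₗ[k] M.complex.X n)
    (hd : ∀ n x, f (n + 1) (L.diff n x) = M.diff n (f n x))
    (hb : ∀ p q n h x y, f n (L.bracket p q n h x y) = M.bracket p q n h (f p x) (f q y)) :
    L ⟶ M :=
  ({ toHom := CochainComplex.ofHom (fun n => ModuleCat.ofHom (f n)) (fun n => by
        ext x
        exact (hd n x).symm)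
     map_bracket := hb } : Hom L M)

section ofModules

variable (M : ℤ → Type u) [∀ n, AddCommGroup (M n)] [∀ n, Module k (M n)]
  (d : ∀ n, M n →ₗ[k] M (n + 1)) (hd : ∀ n x, d (n + 1) (d n x) = 0)
  (br : ∀ p q n : ℤ, p + q = n → (M p →ₗ[k] M q →ₗ[k] M n))
  (antisymm : ∀ (p q n : ℤ) (h : p + q = n) (h' : q + p = n) (x : M p) (y : M q),
    br p q n h x y = (p * q + 1).negOnePow • br q p n h' y x)
  (jacobi : ∀ (p q r qr rp pq n : ℤ) (hqr : q + r = qr) (hrp : r + p = rp) (hpq : p + q = pq)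
    (h₁ : p + qr = n) (h₂ : q + rp = n) (h₃ : r + pq = n) (x : M p) (y : M q) (z : M r),
    br p qr n h₁ x (br q r qr hqr y z)
      + (r * p + p * q).negOnePow • br q rp n h₂ y (br r p rp hrp z x)
      + (r * p + r * q).negOnePow • br r pq n h₃ z (br p q pq hpq x y) = 0)
  (leibniz : ∀ (p q n : ℤ) (h : p + q = n) (h₁ : p + 1 + q = n + 1) (h₂ : p + (q + 1) = n + 1)
    (x : M p) (y : M q), d n (br p q n h x y) =
      br (p + 1) q (n + 1) h₁ (d p x) y + p.negOnePow • br p (q + 1) (n + 1) h₂ x (d q y))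

/-- A constructor for dg-Lie algebras from a family of modules. -/
def ofModules : DGLieAlgebra k where
  complex := CochainComplex.of (fun n => ModuleCat.of k (M n)) (fun n => ModuleCat.ofHom (d n))
    (fun n => by ext x; exact hd n x)
  bracket := br
  antisymm := antisymm
  jacobi := jacobi
  leibniz := by
    intro p p' q q' n n' hp hq hn h h₁ h₂ x y
    subst hp hq hn
    simp only [CochainComplex.of_d]
    exact leibniz p q n h h₁ h₂ x y

theorem ofModules_diff (n : ℤ) (x : M n) :
    (ofModules M d hd br antisymm jacobi leibniz).diff n x = d n x := by
  simp only [ofModules, diff, CochainComplex.of_d]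
  rfl

end ofModules

end DGLieAlgebra

/-! ### Finite limits, computed degreewise, and the zero algebra -/

namespace DGLieAlgebra

variable {k : Type u} [CommRing k]

section Limits

open Limits

variable {J : Type} [SmallCategory J] (F : J ⥤ DGLieAlgebra k)

/-- The compatible families of elements of degree `n` in a diagram of dg-Lie algebras. -/
def limitModule (n : ℤ) : Submodule k (∀ j, (F.obj j).complex.X n) where
  carrier := {x | ∀ i j (f : i ⟶ j), Hom.app (F.map f) n (x i) = x j}
  add_mem' := fun hx hy i j f => by
    simp only [Pi.add_apply, map_add, hx i j f, hy i j f]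
  zero_mem' := fun i j f => by simp only [Pi.zero_apply, map_zero]
  smul_mem' := fun c x hx i j f => by simp only [Pi.smul_apply, map_smul, hx i j f]

theorem limitModule_ext {n : ℤ} {x y : limitModule F n} (h : ∀ j, x.1 j = y.1 j) : x = y :=
  Subtype.ext (funext h)

/-- The differential on compatible families. -/
def limitDiff (n : ℤ) : limitModule F n →ₗ[k] limitModule F (n + 1) where
  toFun x := ⟨fun j => (F.obj j).diff n (x.1 j), fun i j f => by
    rw [Hom.app_diff, x.2 i j f]⟩
  map_add' x y := limitModule_ext F fun j => map_add ((F.obj j).diff n) _ _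
  map_smul' c x := limitModule_ext F fun j => map_smul ((F.obj j).diff n) _ _

/-- The bracket on compatible families. -/
def limitBracket (p q n : ℤ) (h : p + q = n) :
    limitModule F p →ₗ[k] limitModule F q →ₗ[k] limitModule F n :=
  LinearMap.mk₂ k
    (fun x y => ⟨fun j => (F.obj j).bracket p q n h (x.1 j) (y.1 j), fun i j f => by
      rw [Hom.app_bracket, x.2 i j f, y.2 i j f]⟩)
    (fun x x' y => limitModule_ext F fun j =>
      LinearMap.map_add₂ ((F.obj j).bracket p q n h) _ _ _)
    (fun c x y => limitModule_ext F fun j =>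
      LinearMap.map_smul₂ ((F.obj j).bracket p q n h) _ _ _)
    (fun x y y' => limitModule_ext F fun j => map_add ((F.obj j).bracket p q n h (x.1 j)) _ _)
    (fun c x y => limitModule_ext F fun j => map_smul ((F.obj j).bracket p q n h (x.1 j)) _ _)

/-- The limit of a diagram of dg-Lie algebras. -/
def limitAlgebra : DGLieAlgebra k :=
  ofModules (fun n => limitModule F n) (limitDiff F)
    (fun n x => limitModule_ext F fun j => (F.obj j).diff_diff n (x.1 j))
    (limitBracket F)
    (fun p q n h h' x y => limitModule_ext F fun j =>
      (F.obj j).antisymm p q n h h' (x.1 j) (y.1 j))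
    (fun p q r qr rp pq n hqr hrp hpq h₁ h₂ h₃ x y z => limitModule_ext F fun j =>
      (F.obj j).jacobi p q r qr rp pq n hqr hrp hpq h₁ h₂ h₃ (x.1 j) (y.1 j) (z.1 j))
    (fun p q n h h₁ h₂ x y => limitModule_ext F fun j =>
      (F.obj j).leibniz p (p + 1) q (q + 1) n (n + 1) rfl rfl rfl h h₁ h₂ (x.1 j) (y.1 j))

theorem limitAlgebra_diff (n : ℤ) (x : limitModule F n) :
    (limitAlgebra F).diff n x = limitDiff F n x :=
  ofModules_diff ..

/-- The limit cone of a diagram of dg-Lie algebras. -/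
def limitCone : Cone F where
  pt := limitAlgebra F
  π :=
    { app := fun j => homMk (L := limitAlgebra F)
        (fun n => (LinearMap.proj j).comp (limitModule F n).subtype)
        (fun n x =>
          congrArg (fun y : limitModule F (n + 1) => y.1 j) (limitAlgebra_diff F n x))
        (fun _ _ _ _ _ _ => rfl)
      naturality := fun i j f => hom_ext fun _ x => (x.2 i j f).symm }

/-- The limit cone is a limit. -/
def limitConeIsLimit : IsLimit (limitCone F) where
  lift s := homMk (M := limitAlgebra F)
    (fun n => LinearMap.codRestrict (limitModule F n)
      (LinearMap.pi fun j => Hom.app (s.π.app j) n) (fun x i j f => by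
        have h : Hom.app (s.π.app i ≫ F.map f) n x = Hom.app (s.π.app j) n x := by rw [s.w]
        exact h))
    (fun n x => Eq.trans
      (b := limitDiff F n ⟨fun j => Hom.app (s.π.app j) n x, fun i j f => by
        have h : Hom.app (s.π.app i ≫ F.map f) n x = Hom.app (s.π.app j) n x := by rw [s.w]
        exact h⟩)
      (limitModule_ext F fun j => Hom.app_diff (s.π.app j) n x)
      (limitAlgebra_diff F n _).symm)
    (fun p q n h x y => limitModule_ext F fun j => Hom.app_bracket (s.π.app j) h x y)
  fac s j := hom_ext fun n x => rfl
  uniq s m hm := hom_ext fun n x => limitModule_ext F fun j =>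
    congrArg (fun f : s.pt ⟶ F.obj j => Hom.app f n x) (hm j)

instance : HasFiniteLimits (DGLieAlgebra k) where
  out _ _ _ := { has_limit := fun F => ⟨⟨⟨limitCone F, limitConeIsLimit F⟩⟩⟩ }

end Limits

variable (k) in
/-- The zero dg-Lie algebra. -/
def zeroAlgebra : DGLieAlgebra k :=
  ofModules (fun _ => PUnit) (fun _ => 0) (fun _ _ => rfl) (fun _ _ _ _ => 0)
    (fun _ _ _ _ _ _ _ => rfl) (fun _ _ _ _ _ _ _ _ _ _ _ _ _ _ _ _ => rfl)
    (fun _ _ _ _ _ _ _ _ => rfl)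

instance (n : ℤ) : Subsingleton ((zeroAlgebra k).complex.X n) :=
  inferInstanceAs (Subsingleton PUnit)

/-- The morphism to the zero dg-Lie algebra. -/
def toZeroAlgebra (L : DGLieAlgebra k) : L ⟶ zeroAlgebra k :=
  homMk (fun _ => 0) (fun _ _ => Subsingleton.elim _ _) (fun _ _ _ _ _ _ => Subsingleton.elim _ _)

end DGLieAlgebra

/-! ### Signs, derivation identities and formal expressions -/

namespace DGLieAlgebra

variable {k : Type u} [CommRing k]

section Sign

variable (k) in
/-- The sign `(-1)^n`, as a scalar. -/
def sgn (n : ℤ) : k := ((n.negOnePow : ℤ) : k)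

theorem sgn_smul {M : Type*} [AddCommGroup M] [Module k M] (n : ℤ) (x : M) :
    n.negOnePow • x = sgn k n • x := by
  rw [sgn, Units.smul_def, Int.cast_smul_eq_zsmul]

theorem sgn_eq (n : ℤ) : sgn k n = if Even n then 1 else -1 := by
  split_ifs with h
  · simp [sgn, Int.negOnePow_even n h]
  · simp [sgn, Int.negOnePow_odd n (Int.not_even_iff_odd.1 h)]

end Sign

section Identities

variable {M : ℤ → Type u} [∀ n, AddCommGroup (M n)] [∀ n, Module k (M n)]
  (br : ∀ p q n : ℤ, p + q = n → (M p →ₗ[k] M q →ₗ[k] M n))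
  (antisymm : ∀ (p q n : ℤ) (h : p + q = n) (h' : q + p = n) (x : M p) (y : M q),
    br p q n h x y = sgn k (p * q + 1) • br q p n h' y x)
  (jacobi : ∀ (p q r qr rp pq n : ℤ) (hqr : q + r = qr) (hrp : r + p = rp) (hpq : p + q = pq)
    (h₁ : p + qr = n) (h₂ : q + rp = n) (h₃ : r + pq = n) (x : M p) (y : M q) (z : M r),
    br p qr n h₁ x (br q r qr hqr y z)
      + sgn k (r * p + p * q) • br q rp n h₂ y (br r p rp hrp z x)
      + sgn k (r * p + r * q) • br r pq n h₃ z (br p q pq hpq x y) = 0)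

include antisymm in
/-- A graded derivation respects the antisymmetry of the bracket. -/
theorem derivation_antisymm (e p q n : ℤ) (h₁ : p + e + q = n + e) (h₂ : p + (q + e) = n + e)
    (h₃ : q + e + p = n + e) (h₄ : q + (p + e) = n + e)
    (x : M p) (y : M q) (x' : M (p + e)) (y' : M (q + e)) :
    br (p + e) q (n + e) h₁ x' y + sgn k (e * p) • br p (q + e) (n + e) h₂ x y' =
      sgn k (p * q + 1) • (br (q + e) p (n + e) h₃ y' x
        + sgn k (e * q) • br q (p + e) (n + e) h₄ y x') := by
  rw [antisymm (p + e) q (n + e) h₁ h₄, antisymm p (q + e) (n + e) h₂ h₃]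
  -- All signs depend only on the parities of `e`, `p`, `q`, which leaves eight cases of additive
  -- algebra.
  simp only [sgn_eq, Int.even_add, Int.even_mul]
  by_cases he : Even e <;> by_cases hp : Even p <;> by_cases hq : Even q <;>
    simp [he, hp, hq] <;> abel

include jacobi in
/-- A graded derivation respects the Jacobi identity. -/
theorem derivation_jacobi (e p q r qr rp pq n : ℤ) (hqr : q + r = qr) (hrp : r + p = rp)
    (hpq : p + q = pq) (h₁ : p + qr = n) (h₂ : q + rp = n) (h₃ : r + pq = n)
    (x : M p) (y : M q) (z : M r) (x' : M (p + e)) (y' : M (q + e)) (z' : M (r + e)) :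
    (br (p + e) qr (n + e) (by lia) x' (br q r qr hqr y z)
      + sgn k (e * p) • br p (qr + e) (n + e) (by lia) x
        (br (q + e) r (qr + e) (by lia) y' z
          + sgn k (e * q) • br q (r + e) (qr + e) (by lia) y z'))
      + sgn k (r * p + p * q) • (br (q + e) rp (n + e) (by lia) y' (br r p rp hrp z x)
      + sgn k (e * q) • br q (rp + e) (n + e) (by lia) y
        (br (r + e) p (rp + e) (by lia) z' x
          + sgn k (e * r) • br r (p + e) (rp + e) (by lia) z x'))
      + sgn k (r * p + r * q) • (br (r + e) pq (n + e) (by lia) z' (br p q pq hpq x y)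
      + sgn k (e * r) • br r (pq + e) (n + e) (by lia) z
        (br (p + e) q (pq + e) (by lia) x' y
          + sgn k (e * p) • br p (q + e) (pq + e) (by lia) x y')) = 0 := by
  -- The derived identity is a signed sum of three Jacobi identities, in each of which one of the
  -- entries has been replaced by its derivative.
  have J₁ := jacobi (p + e) q r qr (rp + e) (pq + e) (n + e) hqr (by lia) (by lia) (by lia)
    (by lia) (by lia) x' y z
  have J₂ := jacobi p (q + e) r (qr + e) rp (pq + e) (n + e) (by lia) hrp (by lia) (by lia)
    (by lia) (by lia) x y' z
  have J₃ := jacobi p q (r + e) (qr + e) (rp + e) pq (n + e) (by lia) (by lia) hpq (by lia)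
    (by lia) (by lia) x y z'
  simp only [sgn_eq, Int.even_add, Int.even_mul] at J₁ J₂ J₃ ⊢
  by_cases he : Even e <;> by_cases hp : Even p <;> by_cases hq : Even q <;>
    by_cases hr : Even r <;> simp [he, hp, hq, hr] at J₁ J₂ J₃ ⊢ <;>
    first
      | linear_combination (norm := abel1) J₁ + J₂ + J₃
      | linear_combination (norm := abel1) J₁ - J₂ + J₃
      | linear_combination (norm := abel1) J₁ + J₂ - J₃
      | linear_combination (norm := abel1) J₁ - J₂ - J₃

end Identities

variable {J : Type} [SmallCategory J]

/-- Formal expressions of degree `n` in the elements of a diagram of dg-Lie algebras and in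
further generators: for an expression `t` of degree `n + 1` and a label `l : Λ n`, there is a
generator `cell t l` of degree `n`, whose differential is meant to be `t`. -/
inductive Term (F : J ⥤ DGLieAlgebra k) (Λ : ℤ → Type u) : ℤ → Type u
  | zero {n : ℤ} : Term F Λ n
  | add {n : ℤ} : Term F Λ n → Term F Λ n → Term F Λ n
  | smul {n : ℤ} : k → Term F Λ n → Term F Λ n
  | gen {n : ℤ} (j : J) : (F.obj j).complex.X n → Term F Λ n
  | cell {n : ℤ} : Term F Λ (n + 1) → Λ n → Term F Λ n
  | bracket {p q n : ℤ} (h : p + q = n) : Term F Λ p → Term F Λ q → Term F Λ n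

namespace Term

variable {F : J ⥤ DGLieAlgebra k} {Λ : ℤ → Type u}

/-- The extension to all expressions of a derivation of degree `e`, given on the generators. -/
def der (e : ℤ) (δ : ∀ (n : ℤ) (j : J), (F.obj j).complex.X n → Term F Λ (n + e))
    (κ : ∀ n : ℤ, Term F Λ (n + 1) → Λ n → Term F Λ (n + e)) :
    ∀ {n : ℤ}, Term F Λ n → Term F Λ (n + e)
  | _, zero => zero
  | _, add s t => add (der e δ κ s) (der e δ κ t)
  | _, smul c t => smul c (der e δ κ t)
  | _, gen j a => δ _ j a
  | _, cell t l => κ _ t l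
  | _, bracket (p := p) (q := q) (n := n) h s t =>
      add (bracket (p := p + e) (q := q) (n := n + e) (by lia) (der e δ κ s) t)
        (smul (sgn k (e * p))
          (bracket (p := p) (q := q + e) (n := n + e) (by lia) s (der e δ κ t)))

/-- The differential of an expression. -/
def diff {n : ℤ} (t : Term F Λ n) : Term F Λ (n + 1) :=
  der 1 (fun n j a => gen j ((F.obj j).diff n a)) (fun _ t _ => t) t

/-- Equality of formal expressions. An expression is meaningful if it is equal to itself; a
generator `cell t l` is meaningful if `t` is a cocycle and the condition `V n t l` holds. -/
inductive Rel (V : ∀ n : ℤ, Term F Λ (n + 1) → Λ n → Prop) :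
    ∀ {n : ℤ}, Term F Λ n → Term F Λ n → Prop
  | symm {n : ℤ} {s t : Term F Λ n} : Rel V s t → Rel V t s
  | trans {n : ℤ} {r s t : Term F Λ n} : Rel V r s → Rel V s t → Rel V r t
  | zero {n : ℤ} : Rel V (zero : Term F Λ n) zero
  | add {n : ℤ} {s s' t t' : Term F Λ n} :
      Rel V s s' → Rel V t t' → Rel V (add s t) (add s' t')
  | smul {n : ℤ} (c : k) {t t' : Term F Λ n} : Rel V t t' → Rel V (smul c t) (smul c t')
  | bracket {p q n : ℤ} (h : p + q = n) {s s' : Term F Λ p} {t t' : Term F Λ q} :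
      Rel V s s' → Rel V t t' → Rel V (bracket h s t) (bracket h s' t')
  | gen {n : ℤ} (j : J) (a : (F.obj j).complex.X n) : Rel V (gen j a) (gen j a)
  | cell {n : ℤ} {t : Term F Λ (n + 1)} {l : Λ n} :
      V n t l → Rel V t t → Rel V (diff t) Term.zero → Rel V (cell t l) (cell t l)
  | gen_add {n : ℤ} (j : J) (a b : (F.obj j).complex.X n) :
      Rel V (Term.gen j (a + b)) (Term.add (Term.gen j a) (Term.gen j b))
  | gen_smul {n : ℤ} (j : J) (c : k) (a : (F.obj j).complex.X n) :
      Rel V (Term.gen j (c • a)) (Term.smul c (Term.gen j a))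
  | gen_bracket {p q n : ℤ} (h : p + q = n) (j : J) (a : (F.obj j).complex.X p)
      (b : (F.obj j).complex.X q) :
      Rel V (Term.gen j ((F.obj j).bracket p q n h a b))
        (Term.bracket h (Term.gen j a) (Term.gen j b))
  | gen_map {n : ℤ} {i j : J} (f : i ⟶ j) (a : (F.obj i).complex.X n) :
      Rel V (Term.gen j (Hom.app (F.map f) n a)) (Term.gen i a)
  | add_comm {n : ℤ} {s t : Term F Λ n} :
      Rel V s s → Rel V t t → Rel V (Term.add s t) (Term.add t s)
  | add_assoc {n : ℤ} {r s t : Term F Λ n} : Rel V r r → Rel V s s → Rel V t t →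
      Rel V (Term.add (Term.add r s) t) (Term.add r (Term.add s t))
  | zero_add {n : ℤ} {t : Term F Λ n} : Rel V t t → Rel V (Term.add Term.zero t) t
  | neg_add {n : ℤ} {t : Term F Λ n} :
      Rel V t t → Rel V (Term.add (Term.smul (-1) t) t) Term.zero
  | smul_add {n : ℤ} (c : k) {s t : Term F Λ n} : Rel V s s → Rel V t t →
      Rel V (Term.smul c (Term.add s t)) (Term.add (Term.smul c s) (Term.smul c t))
  | add_smul {n : ℤ} (c c' : k) {t : Term F Λ n} : Rel V t t →
      Rel V (Term.smul (c + c') t) (Term.add (Term.smul c t) (Term.smul c' t))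
  | mul_smul {n : ℤ} (c c' : k) {t : Term F Λ n} : Rel V t t →
      Rel V (Term.smul (c * c') t) (Term.smul c (Term.smul c' t))
  | one_smul {n : ℤ} {t : Term F Λ n} : Rel V t t → Rel V (Term.smul 1 t) t
  | add_bracket {p q n : ℤ} (h : p + q = n) {r s : Term F Λ p} {t : Term F Λ q} :
      Rel V r r → Rel V s s → Rel V t t →
      Rel V (Term.bracket h (Term.add r s) t)
        (Term.add (Term.bracket h r t) (Term.bracket h s t))
  | smul_bracket {p q n : ℤ} (h : p + q = n) (c : k) {s : Term F Λ p} {t : Term F Λ q} :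
      Rel V s s → Rel V t t →
      Rel V (Term.bracket h (Term.smul c s) t) (Term.smul c (Term.bracket h s t))
  | antisymm {p q n : ℤ} (h : p + q = n) (h' : q + p = n) {s : Term F Λ p} {t : Term F Λ q} :
      Rel V s s → Rel V t t →
      Rel V (Term.bracket h s t) (Term.smul (sgn k (p * q + 1)) (Term.bracket h' t s))
  | jacobi {p q r qr rp pq n : ℤ} (hqr : q + r = qr) (hrp : r + p = rp) (hpq : p + q = pq)
      (h₁ : p + qr = n) (h₂ : q + rp = n) (h₃ : r + pq = n)
      {x : Term F Λ p} {y : Term F Λ q} {z : Term F Λ r} :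
      Rel V x x → Rel V y y → Rel V z z →
      Rel V (Term.add (Term.add (Term.bracket h₁ x (Term.bracket hqr y z))
        (Term.smul (sgn k (r * p + p * q)) (Term.bracket h₂ y (Term.bracket hrp z x))))
        (Term.smul (sgn k (r * p + r * q)) (Term.bracket h₃ z (Term.bracket hpq x y)))) Term.zero

end Term

end DGLieAlgebra

/-! ### Classes of expressions and the extension of derivations to them -/

namespace DGLieAlgebra

variable {k : Type u} [CommRing k]

variable {J : Type} [SmallCategory J]

namespace Term

variable {F : J ⥤ DGLieAlgebra k} {Λ : ℤ → Type u} {V : ∀ n : ℤ, Term F Λ (n + 1) → Λ n → Prop}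

theorem Rel.left {n : ℤ} {s t : Term F Λ n} (h : Rel V s t) : Rel V s s :=
  h.trans h.symm

theorem Rel.right {n : ℤ} {s t : Term F Λ n} (h : Rel V s t) : Rel V t t :=
  h.symm.trans h

variable (V) in
/-- The meaningful expressions of degree `n`. -/
abbrev Valid (n : ℤ) : Type u := {t : Term F Λ n // Rel V t t}

instance validSetoid (n : ℤ) : Setoid (Valid V n) where
  r s t := Rel V s.1 t.1
  iseqv := ⟨fun s => s.2, Rel.symm, Rel.trans⟩

variable (V) in
/-- The meaningful expressions of degree `n`, up to equality of expressions. -/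
def Class (n : ℤ) : Type u := _root_.Quotient (validSetoid (V := V) n)

/-- The class of a meaningful expression. -/
def mk {n : ℤ} (t : Term F Λ n) (ht : Rel V t t) : Class V n := _root_.Quotient.mk _ ⟨t, ht⟩

theorem mk_surjective {n : ℤ} (x : Class V n) : ∃ t ht, mk (V := V) (n := n) t ht = x := by
  obtain ⟨⟨t, ht⟩, rfl⟩ := _root_.Quotient.exists_rep x
  exact ⟨t, ht, rfl⟩

namespace Class

instance (n : ℤ) : Zero (Class V n) := ⟨mk zero Rel.zero⟩

instance (n : ℤ) : Add (Class V n) :=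
  ⟨_root_.Quotient.map₂ (fun s t => ⟨add s.1 t.1, s.2.add t.2⟩) fun _ _ h _ _ h' => Rel.add h h'⟩

instance (n : ℤ) : SMul k (Class V n) :=
  ⟨fun c => _root_.Quotient.map (fun t => ⟨smul c t.1, t.2.smul c⟩) fun _ _ h => Rel.smul c h⟩

instance (n : ℤ) : Neg (Class V n) := ⟨fun x => (-1 : k) • x⟩

end Class

namespace Class

instance (n : ℤ) : AddCommGroup (Class V n) where
  add_assoc := by
    rintro ⟨r, hr⟩ ⟨s, hs⟩ ⟨t, ht⟩
    exact _root_.Quotient.sound (Rel.add_assoc hr hs ht)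
  zero_add := by
    rintro ⟨t, ht⟩
    exact _root_.Quotient.sound (Rel.zero_add ht)
  add_zero := by
    rintro ⟨t, ht⟩
    exact _root_.Quotient.sound ((Rel.add_comm ht Rel.zero).trans (Rel.zero_add ht))
  nsmul := nsmulRec
  zsmul := zsmulRec
  neg_add_cancel := by
    rintro ⟨t, ht⟩
    exact _root_.Quotient.sound (Rel.neg_add ht)
  add_comm := by
    rintro ⟨s, hs⟩ ⟨t, ht⟩
    exact _root_.Quotient.sound (Rel.add_comm hs ht)

instance (n : ℤ) : Module k (Class V n) :=
  Module.ofMinimalAxioms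
    (by
      rintro c ⟨s, hs⟩ ⟨t, ht⟩
      exact _root_.Quotient.sound (Rel.smul_add c hs ht))
    (by
      rintro c c' ⟨t, ht⟩
      exact _root_.Quotient.sound (Rel.add_smul c c' ht))
    (by
      rintro c c' ⟨t, ht⟩
      exact _root_.Quotient.sound (Rel.mul_smul c c' ht))
    (by
      rintro ⟨t, ht⟩
      exact _root_.Quotient.sound (Rel.one_smul ht))

/-- The bracket of two classes of expressions, as a function. -/
def bracketFun (p q n : ℤ) (h : p + q = n) : Class V p → Class V q → Class V n :=
  _root_.Quotient.map₂ (fun s t => ⟨Term.bracket h s.1 t.1, s.2.bracket h t.2⟩)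
    fun _ _ h₁ _ _ h₂ => Rel.bracket h h₁ h₂

theorem bracketFun_antisymm (p q n : ℤ) (h : p + q = n) (h' : q + p = n) (x : Class V p)
    (y : Class V q) :
    bracketFun p q n h x y = sgn k (p * q + 1) • bracketFun q p n h' y x := by
  obtain ⟨s, hs⟩ := x
  obtain ⟨t, ht⟩ := y
  exact _root_.Quotient.sound (Rel.antisymm h h' hs ht)

theorem bracketFun_add_left (p q n : ℤ) (h : p + q = n) (x x' : Class V p) (y : Class V q) :
    bracketFun p q n h (x + x') y = bracketFun p q n h x y + bracketFun p q n h x' y := by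
  obtain ⟨r, hr⟩ := x
  obtain ⟨s, hs⟩ := x'
  obtain ⟨t, ht⟩ := y
  exact _root_.Quotient.sound (Rel.add_bracket h hr hs ht)

theorem bracketFun_smul_left (p q n : ℤ) (h : p + q = n) (c : k) (x : Class V p)
    (y : Class V q) : bracketFun p q n h (c • x) y = c • bracketFun p q n h x y := by
  obtain ⟨s, hs⟩ := x
  obtain ⟨t, ht⟩ := y
  exact _root_.Quotient.sound (Rel.smul_bracket h c hs ht)

/-- The bracket of two classes of expressions. -/
def bracket (p q n : ℤ) (h : p + q = n) : Class V p →ₗ[k] Class V q →ₗ[k] Class V n :=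
  LinearMap.mk₂ k (bracketFun p q n h) (bracketFun_add_left p q n h)
    (bracketFun_smul_left p q n h)
    -- `Rel` imposes linearity only in the left argument; antisymmetry transfers it to the right
    -- one.
    (fun x y y' => by
      have h' : q + p = n := by lia
      simp only [bracketFun_antisymm p q n h h', bracketFun_add_left, smul_add])
    (fun c x y => by
      have h' : q + p = n := by lia
      simp only [bracketFun_antisymm p q n h h', bracketFun_smul_left, smul_comm c])

theorem bracket_antisymm (p q n : ℤ) (h : p + q = n) (h' : q + p = n) (x : Class V p)
    (y : Class V q) : bracket p q n h x y = sgn k (p * q + 1) • bracket q p n h' y x :=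
  bracketFun_antisymm p q n h h' x y

theorem bracket_jacobi (p q r qr rp pq n : ℤ) (hqr : q + r = qr) (hrp : r + p = rp)
    (hpq : p + q = pq) (h₁ : p + qr = n) (h₂ : q + rp = n) (h₃ : r + pq = n)
    (x : Class V p) (y : Class V q) (z : Class V r) :
    bracket p qr n h₁ x (bracket q r qr hqr y z)
      + sgn k (r * p + p * q) • bracket q rp n h₂ y (bracket r p rp hrp z x)
      + sgn k (r * p + r * q) • bracket r pq n h₃ z (bracket p q pq hpq x y) = 0 := by
  obtain ⟨x, hx⟩ := x
  obtain ⟨y, hy⟩ := y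
  obtain ⟨z, hz⟩ := z
  exact _root_.Quotient.sound (Rel.jacobi hqr hrp hpq h₁ h₂ h₃ hx hy hz)

end Class

/-- A derivation given on the generators extends to classes of expressions. -/
theorem Rel.der {e : ℤ} {δ : ∀ (n : ℤ) (j : J), (F.obj j).complex.X n → Term F Λ (n + e)}
    {κ : ∀ n : ℤ, Term F Λ (n + 1) → Λ n → Term F Λ (n + e)}
    (hδ : ∀ n j a, Rel V (δ n j a) (δ n j a))
    (hadd : ∀ n j a b, Rel V (δ n j (a + b)) (Term.add (δ n j a) (δ n j b)))
    (hsmul : ∀ n j (c : k) a, Rel V (δ n j (c • a)) (Term.smul c (δ n j a)))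
    (hbr : ∀ (p q n : ℤ) (h : p + q = n) (h₁ : p + e + q = n + e) (h₂ : p + (q + e) = n + e) j a b,
      Rel V (δ n j ((F.obj j).bracket p q n h a b))
        (Term.add (Term.bracket h₁ (δ p j a) (Term.gen j b))
          (Term.smul (sgn k (e * p)) (Term.bracket h₂ (Term.gen j a) (δ q j b)))))
    (hmap : ∀ (n : ℤ) i j (f : i ⟶ j) a, Rel V (δ n j (Hom.app (F.map f) n a)) (δ n i a))
    (hκ : ∀ n t l, V n t l → Rel V t t → Rel V (diff t) Term.zero → Rel V (κ n t l) (κ n t l))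
    {n : ℤ} {s t : Term F Λ n} (h : Rel V s t) :
    Rel V (Term.der e δ κ s) (Term.der e δ κ t) := by
  induction h with
  | symm _ ih => exact ih.symm
  | trans _ _ ih ih' => exact ih.trans ih'
  | zero => exact Rel.zero
  | add _ _ ih ih' => exact Rel.add ih ih'
  | smul c _ ih => exact Rel.smul c ih
  | bracket h hs ht ih ih' =>
    exact Rel.add (Rel.bracket _ ih ht) (Rel.smul _ (Rel.bracket _ hs ih'))
  | gen j a => exact hδ _ j a
  | cell hV ht hd => exact hκ _ _ _ hV ht hd
  | gen_add j a b => exact hadd _ j a b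
  | gen_smul j c a => exact hsmul _ j c a
  | gen_bracket h j a b => exact hbr _ _ _ h _ _ j a b
  | gen_map f a => exact hmap _ _ _ f a
  | add_comm _ _ ih ih' => exact Rel.add_comm ih ih'
  | add_assoc _ _ _ ih ih' ih'' => exact Rel.add_assoc ih ih' ih''
  | zero_add _ ih => exact Rel.zero_add ih
  | neg_add _ ih => exact Rel.neg_add ih
  | smul_add c _ _ ih ih' => exact Rel.smul_add c ih ih'
  | add_smul c c' _ ih => exact Rel.add_smul c c' ih
  | mul_smul c c' _ ih => exact Rel.mul_smul c c' ih
  | one_smul _ ih => exact Rel.one_smul ih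
  | add_bracket h hr hs ht ih ih' ih'' =>
    rename_i p q n r s t
    -- The required relation is an identity in the quotient, where the module structure is
    -- available; exactness of the quotient turns it back into a relation.
    have key (x x' : Class V p) (y : Class V q) (dx dx' : Class V (p + e))
        (dy : Class V (q + e)) (h₁ : p + e + q = n + e) (h₂ : p + (q + e) = n + e) :
        Class.bracket _ _ _ h₁ (dx + dx') y
          + sgn k (e * p) • Class.bracket _ _ _ h₂ (x + x') dy =
        (Class.bracket _ _ _ h₁ dx y + sgn k (e * p) • Class.bracket _ _ _ h₂ x dy)
          + (Class.bracket _ _ _ h₁ dx' y + sgn k (e * p) • Class.bracket _ _ _ h₂ x' dy) := by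
      simp only [map_add, LinearMap.add_apply, _root_.smul_add]
      abel
    exact _root_.Quotient.exact (key (mk r hr) (mk s hs) (mk t ht) (mk _ ih) (mk _ ih') (mk _ ih'')
      (by lia) (by lia))
  | smul_bracket h c hs ht ih ih' =>
    rename_i p q n s t
    have key (x : Class V p) (y : Class V q) (dx : Class V (p + e))
        (dy : Class V (q + e)) (h₁ : p + e + q = n + e) (h₂ : p + (q + e) = n + e) :
        Class.bracket _ _ _ h₁ (c • dx) y
          + sgn k (e * p) • Class.bracket _ _ _ h₂ (c • x) dy =
        c • (Class.bracket _ _ _ h₁ dx y + sgn k (e * p) • Class.bracket _ _ _ h₂ x dy) := by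
      simp only [map_smul, LinearMap.smul_apply, _root_.smul_add, smul_comm c]
    exact _root_.Quotient.exact (key (mk s hs) (mk t ht) (mk _ ih) (mk _ ih') (by lia) (by lia))
  | antisymm h h' hs ht ih ih' =>
    exact _root_.Quotient.exact (derivation_antisymm Class.bracket Class.bracket_antisymm e _ _ _
      _ _ _ _ (mk _ hs) (mk _ ht) (mk _ ih) (mk _ ih'))
  | jacobi hqr hrp hpq h₁ h₂ h₃ hx hy hz ih ih' ih'' =>
    exact _root_.Quotient.exact (derivation_jacobi Class.bracket Class.bracket_jacobi e _ _ _ _ _ _ _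
      hqr hrp hpq h₁ h₂ h₃ (mk _ hx) (mk _ hy) (mk _ hz) (mk _ ih) (mk _ ih') (mk _ ih''))

end Term

end DGLieAlgebra

/-! ### The differential on classes and the presented algebra -/

namespace DGLieAlgebra

variable {k : Type u} [CommRing k]

variable {J : Type} [SmallCategory J]

namespace Term

variable {F : J ⥤ DGLieAlgebra k} {Λ : ℤ → Type u} {V : ∀ n : ℤ, Term F Λ (n + 1) → Λ n → Prop}

/-- Induction principle for meaningful expressions. -/
theorem Rel.induction_valid {Q : ∀ {n : ℤ}, Term F Λ n → Prop}
    (zero : ∀ n, Q (Term.zero : Term F Λ n))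
    (add : ∀ {n} {s t : Term F Λ n}, Q s → Q t → Q (Term.add s t))
    (smul : ∀ {n} (c : k) {t : Term F Λ n}, Q t → Q (Term.smul c t))
    (gen : ∀ {n} (j : J) (a : (F.obj j).complex.X n), Q (Term.gen j a))
    (cell : ∀ {n} {t : Term F Λ (n + 1)} {l : Λ n}, V n t l → Rel V t t →
      Rel V (Term.diff t) Term.zero → Q t → Q (Term.cell t l))
    (bracket : ∀ {p q n} (h : p + q = n) {s : Term F Λ p} {t : Term F Λ q}, Q s → Q t →
      Q (Term.bracket h s t))
    {n : ℤ} {s t : Term F Λ n} (h : Rel V s t) : Q s ∧ Q t := by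
  -- Because of `symm` and `trans`, a derivation of `Rel V t t` cannot be inverted into derivations
  -- for the subexpressions of `t`. The induction therefore runs over the derivation and treats both
  -- ends at once.
  induction h with
  | symm _ ih => exact ih.symm
  | trans _ _ ih ih' => exact ⟨ih.1, ih'.2⟩
  | zero => exact ⟨zero _, zero _⟩
  | add _ _ ih ih' => exact ⟨add ih.1 ih'.1, add ih.2 ih'.2⟩
  | smul c _ ih => exact ⟨smul c ih.1, smul c ih.2⟩
  | bracket h _ _ ih ih' => exact ⟨bracket h ih.1 ih'.1, bracket h ih.2 ih'.2⟩
  | gen j a => exact ⟨gen j a, gen j a⟩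
  | cell hV ht hd ih => exact ⟨cell hV ht hd ih.1, cell hV ht hd ih.1⟩
  | gen_add j a b => exact ⟨gen j _, add (gen j a) (gen j b)⟩
  | gen_smul j c a => exact ⟨gen j _, smul c (gen j a)⟩
  | gen_bracket h j a b => exact ⟨gen j _, bracket h (gen j a) (gen j b)⟩
  | gen_map f a => exact ⟨gen _ _, gen _ a⟩
  | add_comm _ _ ih ih' => exact ⟨add ih.1 ih'.1, add ih'.1 ih.1⟩
  | add_assoc _ _ _ ih ih' ih'' =>
    exact ⟨add (add ih.1 ih'.1) ih''.1, add ih.1 (add ih'.1 ih''.1)⟩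
  | zero_add _ ih => exact ⟨add (zero _) ih.1, ih.1⟩
  | neg_add _ ih => exact ⟨add (smul _ ih.1) ih.1, zero _⟩
  | smul_add c _ _ ih ih' => exact ⟨smul c (add ih.1 ih'.1), add (smul c ih.1) (smul c ih'.1)⟩
  | add_smul c c' _ ih => exact ⟨smul _ ih.1, add (smul c ih.1) (smul c' ih.1)⟩
  | mul_smul c c' _ ih => exact ⟨smul _ ih.1, smul c (smul c' ih.1)⟩
  | one_smul _ ih => exact ⟨smul _ ih.1, ih.1⟩
  | add_bracket h _ _ _ ih ih' ih'' =>
    exact ⟨bracket h (add ih.1 ih'.1) ih''.1,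
      add (bracket h ih.1 ih''.1) (bracket h ih'.1 ih''.1)⟩
  | smul_bracket h c _ _ ih ih' =>
    exact ⟨bracket h (smul c ih.1) ih'.1, smul c (bracket h ih.1 ih'.1)⟩
  | antisymm h h' _ _ ih ih' =>
    exact ⟨bracket h ih.1 ih'.1, smul _ (bracket h' ih'.1 ih.1)⟩
  | jacobi hqr hrp hpq h₁ h₂ h₃ _ _ _ ih ih' ih'' =>
    exact ⟨add (add (bracket h₁ ih.1 (bracket hqr ih'.1 ih''.1))
      (smul _ (bracket h₂ ih'.1 (bracket hrp ih''.1 ih.1))))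
      (smul _ (bracket h₃ ih''.1 (bracket hpq ih.1 ih'.1))), zero _⟩

/-- On elements of the diagram this is linearity, the Leibniz rule and naturality of the given
differentials; on a cell the differential is `t`, whose meaningfulness is a premise of `Rel.cell`.
-/
theorem Rel.diff {n : ℤ} {s t : Term F Λ n} (h : Rel V s t) : Rel V (diff s) (diff t) := by
  refine Rel.der (fun _ j a => Rel.gen j _) (fun n j a b => ?_) (fun n j c a => ?_)
    (fun p q n h h₁ h₂ j a b => ?_) (fun n i j f a => ?_) (fun _ _ _ _ ht _ => ht) h
  · rw [map_add]
    exact Rel.gen_add j _ _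
  · rw [map_smul]
    exact Rel.gen_smul j c _
  · rw [(F.obj j).leibniz p (p + 1) q (q + 1) n (n + 1) rfl rfl rfl h h₁ h₂, sgn_smul (k := k),
      one_mul]
    exact (Rel.gen_add j _ _).trans (Rel.add (Rel.gen_bracket h₁ j _ _)
      ((Rel.gen_smul j _ _).trans (Rel.smul _ (Rel.gen_bracket h₂ j _ _))))
  · rw [← Hom.app_diff]
    exact Rel.gen_map f _

namespace Class

/-- A compatible derivation on expressions, as a linear map on classes of expressions. -/
def derMap {e : ℤ} {δ : ∀ (n : ℤ) (j : J), (F.obj j).complex.X n → Term F Λ (n + e)}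
    {κ : ∀ n : ℤ, Term F Λ (n + 1) → Λ n → Term F Λ (n + e)}
    (H : ∀ {n : ℤ} {s t : Term F Λ n}, Rel V s t → Rel V (der e δ κ s) (der e δ κ t))
    (n : ℤ) : Class V n →ₗ[k] Class V (n + e) where
  toFun := _root_.Quotient.map (fun t => ⟨der e δ κ t.1, H t.2⟩) fun _ _ h => H h
  map_add' := by
    rintro ⟨s, hs⟩ ⟨t, ht⟩
    rfl
  map_smul' := by
    rintro c ⟨t, ht⟩
    rfl

theorem derMap_bracket {e : ℤ} {δ : ∀ (n : ℤ) (j : J), (F.obj j).complex.X n → Term F Λ (n + e)}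
    {κ : ∀ n : ℤ, Term F Λ (n + 1) → Λ n → Term F Λ (n + e)}
    (H : ∀ {n : ℤ} {s t : Term F Λ n}, Rel V s t → Rel V (der e δ κ s) (der e δ κ t))
    {p q n : ℤ} (h : p + q = n) (h₁ : p + e + q = n + e) (h₂ : p + (q + e) = n + e)
    (x : Class V p) (y : Class V q) :
    derMap H n (bracket p q n h x y) = bracket (p + e) q (n + e) h₁ (derMap H p x) y
      + sgn k (e * p) • bracket p (q + e) (n + e) h₂ x (derMap H q y) := by
  obtain ⟨s, hs⟩ := x
  obtain ⟨t, ht⟩ := y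
  rfl

theorem induction {P : ∀ n : ℤ, Class V n → Prop} (zero : ∀ n, P n 0)
    (add : ∀ n x y, P n x → P n y → P n (x + y))
    (smul : ∀ n (c : k) x, P n x → P n (c • x))
    (gen : ∀ n j (a : (F.obj j).complex.X n), P n (mk (gen j a) (Rel.gen j a)))
    (cell : ∀ n (t : Term F Λ (n + 1)) l (hV : V n t l) (ht : Rel V t t)
      (hd : Rel V (Term.diff t) Term.zero), P (n + 1) (mk t ht) →
      P n (mk (cell t l) (Rel.cell hV ht hd)))
    (bracket : ∀ p q n h x y, P p x → P q y → P n (bracket p q n h x y))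
    {n : ℤ} (x : Class V n) : P n x := by
  obtain ⟨t, ht, rfl⟩ := mk_surjective x
  have key := Rel.induction_valid (V := V) (Q := fun {n} t => ∃ ht : Rel V t t, P n (mk t ht))
    (fun n => ⟨Rel.zero, zero n⟩)
    (fun ⟨hs, ps⟩ ⟨ht, pt⟩ => ⟨hs.add ht, add _ _ _ ps pt⟩)
    (fun c _ ⟨ht, pt⟩ => ⟨ht.smul c, smul _ c _ pt⟩)
    (fun j a => ⟨Rel.gen j a, gen _ j a⟩)
    (fun hV ht hd ⟨_, pt⟩ => ⟨Rel.cell hV ht hd, cell _ _ _ hV ht hd pt⟩)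
    (fun h _ _ ⟨hs, ps⟩ ⟨ht, pt⟩ => ⟨hs.bracket h ht, bracket _ _ _ h _ _ ps pt⟩) ht
  exact key.1.2

/-- The differential on classes of expressions. -/
def diff (n : ℤ) : Class V n →ₗ[k] Class V (n + 1) := derMap (V := V) Rel.diff n

theorem diff_bracket {p q n : ℤ} (h : p + q = n) (h₁ : p + 1 + q = n + 1)
    (h₂ : p + (q + 1) = n + 1) (x : Class V p) (y : Class V q) :
    diff n (bracket p q n h x y) = bracket (p + 1) q (n + 1) h₁ (diff p x) y
      + sgn k p • bracket p (q + 1) (n + 1) h₂ x (diff q y) := by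
  have key := derMap_bracket (V := V) Rel.diff h h₁ h₂ x y
  rw [one_mul] at key
  exact key

theorem mk_gen_zero (n : ℤ) (j : J) :
    mk (V := V) (Term.gen j (0 : (F.obj j).complex.X n)) (Rel.gen j 0) = 0 := by
  have h : mk (V := V) (Term.gen j ((0 : k) • (0 : (F.obj j).complex.X n))) (Rel.gen j _)
      = (0 : k) • mk (Term.gen j 0) (Rel.gen j _) := _root_.Quotient.sound (Rel.gen_smul j 0 0)
  simpa only [zero_smul] using h

/-- On a cell this is exactly the premise of `Rel.cell` that `t` is a cocycle; on a bracket the two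
mixed terms cancel by sign. -/
theorem diff_diff {n : ℤ} (x : Class V n) : diff (n + 1) (diff n x) = 0 := by
  induction x using Class.induction with
  | zero => simp only [map_zero]
  | add n x y hx hy => simp only [map_add, hx, hy, add_zero]
  | smul n c x hx => simp only [map_smul, hx, smul_zero]
  | gen n j a =>
    have h := (F.obj j).diff_diff n a
    rw [← mk_gen_zero (n + 1 + 1) j, ← h]
    rfl
  | cell n t l hV ht hd _ => exact _root_.Quotient.sound hd
  | bracket p q n h x y hx hy =>
    rw [diff_bracket h (by lia) (by lia), map_add, map_smul,
      diff_bracket (p := p + 1) (n := n + 1) (by lia) (by lia) (by lia),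
      diff_bracket (q := q + 1) (n := n + 1) (by lia) (by lia) (by lia), hx, hy]
    simp only [sgn_eq, Int.even_add_one, map_zero, LinearMap.zero_apply]
    split_ifs <;> simp

end Class

end Term

open Term

variable {F : J ⥤ DGLieAlgebra k} {Λ : ℤ → Type u} (V : ∀ n : ℤ, Term F Λ (n + 1) → Λ n → Prop)

/-- The dg-Lie algebra generated by a diagram of dg-Lie algebras and by further generators
`cell t l`, whenever `t` is a cocycle which satisfies the condition `V n t l`. -/
def presented : DGLieAlgebra k :=
  ofModules (Class V) Class.diff (fun _ => Class.diff_diff) Class.bracket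
    (fun p q n h h' x y => by rw [sgn_smul (k := k)]; exact Class.bracket_antisymm p q n h h' x y)
    (fun p q r qr rp pq n hqr hrp hpq h₁ h₂ h₃ x y z => by
      rw [sgn_smul (k := k), sgn_smul (k := k)]
      exact Class.bracket_jacobi p q r qr rp pq n hqr hrp hpq h₁ h₂ h₃ x y z)
    (fun p q n h h₁ h₂ x y => by rw [sgn_smul (k := k)]; exact Class.diff_bracket h h₁ h₂ x y)

namespace presented

variable {V}

/-- The element of the presented algebra given by a meaningful expression. -/
def cls {n : ℤ} (t : Term F Λ n) (ht : Rel V t t) : (presented V).complex.X n := Term.mk t ht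

theorem cls_eq {n : ℤ} {s t : Term F Λ n} (h : Rel V s t) :
    cls s h.left = cls t h.right :=
  _root_.Quotient.sound h

theorem rel_of_cls_eq {n : ℤ} {s t : Term F Λ n} {hs : Rel V s s} {ht : Rel V t t}
    (h : cls s hs = cls t ht) : Rel V s t :=
  _root_.Quotient.exact h

theorem cls_surjective {n : ℤ} (x : (presented V).complex.X n) :
    ∃ t ht, cls (V := V) (n := n) t ht = x :=
  mk_surjective x

theorem diff_cls {n : ℤ} (t : Term F Λ n) (ht : Rel V t t) :
    (presented V).diff n (cls t ht) = cls t.diff ht.diff :=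
  ofModules_diff ..

variable (V) in
/-- The canonical morphism from a member of the diagram to the presented algebra. -/
def incl (j : J) : F.obj j ⟶ presented V :=
  homMk
    (fun _ =>
      { toFun := fun a => cls (.gen j a) (Rel.gen j a)
        map_add' := fun a b => cls_eq (Rel.gen_add j a b)
        map_smul' := fun c a => cls_eq (Rel.gen_smul j c a) })
    (fun _ a => (diff_cls (.gen j a) (Rel.gen j a)).symm)
    (fun _ _ _ h a b => cls_eq (Rel.gen_bracket h j a b))

theorem map_incl {i j : J} (f : i ⟶ j) : F.map f ≫ incl V j = incl V i :=
  hom_ext fun _ a => cls_eq (Rel.gen_map f a)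

end presented

/-! ### Universal property of presented algebras: evaluation of expressions -/

section Lift

variable {X Y : DGLieAlgebra k} (u : ∀ j, F.obj j ⟶ X)
  (c : ∀ n : ℤ, Term F Λ (n + 1) → X.complex.X (n + 1) → Λ n → X.complex.X n)

/-- The value of an expression in a dg-Lie algebra, for a given rule for the values of the
generators `cell t l`. -/
def Term.eval : ∀ {n : ℤ}, Term F Λ n → X.complex.X n
  | _, .zero => 0
  | _, .add s t => eval s + eval t
  | _, .smul a t => a • eval t
  | _, .gen j a => Hom.app (u j) _ a
  | _, .cell t l => c _ t (eval t) l
  | _, .bracket h s t => X.bracket _ _ _ h (eval s) (eval t)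

variable {V} {u} {c} (p : X ⟶ Y) (v : presented V ⟶ Y)
  (hu : ∀ i j (f : i ⟶ j), F.map f ≫ u j = u i)
  (hup : ∀ j, u j ≫ p = presented.incl V j ≫ v)
  (hc : ∀ (n : ℤ) (t : Term F Λ (n + 1)) (l : Λ n) (hV : V n t l) (ht : Rel V t t)
    (hd : Rel V t.diff .zero), X.diff (n + 1) (t.eval u c) = 0 →
    Hom.app p (n + 1) (t.eval u c) = Hom.app v (n + 1) (presented.cls t ht) →
    X.diff n (c n t (t.eval u c) l) = t.eval u c ∧
      Hom.app p n (c n t (t.eval u c) l) =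
        Hom.app v n (presented.cls (.cell t l) (Rel.cell hV ht hd)))

include hu hup hc in
/-- Equal expressions have equal values, provided that the values of the generators `cell t l`
are correct. -/
theorem Term.Rel.eval_eq {n : ℤ} {s t : Term F Λ n} (h : Rel V s t) :
    s.eval u c = t.eval u c ∧
      (s.diff.eval u c = X.diff n (s.eval u c) ∧
        ∃ hs : Rel V s s, Hom.app p n (s.eval u c) = Hom.app v n (presented.cls s hs)) ∧
      (t.diff.eval u c = X.diff n (t.eval u c) ∧
        ∃ ht : Rel V t t, Hom.app p n (t.eval u c) = Hom.app v n (presented.cls t ht)) := by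
  -- The claims have to be proved together. For `cell t l`, the rule `c` is correct only if the
  -- value of `t` is a cocycle lying over the image of `t` under `v`; the first follows from
  -- compatibility with `diff` and from the equality of values for `diff t` and zero.
  let Q : ∀ {n : ℤ}, Term F Λ n → Prop := fun {n} s =>
    s.diff.eval u c = X.diff n (s.eval u c) ∧
        ∃ hs : Rel V s s, Hom.app p n (s.eval u c) = Hom.app v n (presented.cls s hs)
  have qzero : ∀ n, Q (Term.zero : Term F Λ n) := fun n =>
    ⟨(map_zero _).symm, Rel.zero, (map_zero _).trans (map_zero _).symm⟩
  have qadd : ∀ {n} {s t : Term F Λ n}, Q s → Q t → Q (Term.add s t) :=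
    fun {n s t} ⟨h₁, h₂, h₃⟩ ⟨h₁', h₂', h₃'⟩ =>
      ⟨(congrArg₂ (· + ·) h₁ h₁').trans (map_add _ _ _).symm, h₂.add h₂',
        (map_add _ _ _).trans ((congrArg₂ (· + ·) h₃ h₃').trans (map_add _ _ _).symm)⟩
  have qsmul : ∀ {n} (a : k) {t : Term F Λ n}, Q t → Q (Term.smul a t) :=
    fun {n} a {t} ⟨h₁, h₂, h₃⟩ =>
      ⟨(congrArg (a • ·) h₁).trans (map_smul _ _ _).symm, h₂.smul a,
        (map_smul _ _ _).trans ((congrArg (a • ·) h₃).trans (map_smul _ _ _).symm)⟩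
  have qgen : ∀ {n} (j : J) (a : (F.obj j).complex.X n), Q (Term.gen j a : Term F Λ n) :=
    fun {n} j a => ⟨Hom.app_diff (u j) n a, Rel.gen j a,
      congrArg (fun f : F.obj j ⟶ Y => Hom.app f n a) (hup j)⟩
  have qbracket : ∀ {i j n} (h : i + j = n) {s : Term F Λ i} {t : Term F Λ j}, Q s → Q t →
      Q (Term.bracket h s t) := by
    rintro i j n h s t ⟨h₁, h₂, h₃⟩ ⟨h₁', h₂', h₃'⟩
    refine ⟨?_, h₂.bracket h h₂', ?_⟩
    · have key := X.leibniz i (i + 1) j (j + 1) n (n + 1) rfl rfl rfl h (by lia) (by lia)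
        (s.eval u c) (t.eval u c)
      change X.bracket _ _ _ _ (s.diff.eval u c) (t.eval u c)
        + sgn k (1 * i) • X.bracket _ _ _ _ (s.eval u c) (t.diff.eval u c)
        = X.diff n (X.bracket i j n h (s.eval u c) (t.eval u c))
      rw [h₁, h₁', one_mul, ← sgn_smul]
      exact key.symm
    · have key := Hom.app_bracket v h (presented.cls s h₂) (presented.cls t h₂')
      rw [← h₃, ← h₃'] at key
      exact (Hom.app_bracket p h _ _).trans key.symm
  induction h with
  | symm _ ih => exact ⟨ih.1.symm, ih.2.2, ih.2.1⟩
  | trans _ _ ih ih' => exact ⟨ih.1.trans ih'.1, ih.2.1, ih'.2.2⟩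
  | zero => exact ⟨rfl, qzero _, qzero _⟩
  | add _ _ ih ih' =>
    exact ⟨congrArg₂ (· + ·) ih.1 ih'.1, qadd ih.2.1 ih'.2.1, qadd ih.2.2 ih'.2.2⟩
  | smul a _ ih => exact ⟨congrArg (a • ·) ih.1, qsmul a ih.2.1, qsmul a ih.2.2⟩
  | bracket h _ _ ih ih' =>
    exact ⟨congrArg₂ (fun x y => X.bracket _ _ _ h x y) ih.1 ih'.1, qbracket h ih.2.1 ih'.2.1,
      qbracket h ih.2.2 ih'.2.2⟩
  | gen j a => exact ⟨rfl, qgen j a, qgen j a⟩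
  | cell hV ht hd ih ih' =>
    obtain ⟨-, ⟨h₁, h₂, h₃⟩, -⟩ := ih
    have key := hc _ _ _ hV ht hd (h₁.symm.trans ih'.1) h₃
    exact ⟨rfl, ⟨key.1.symm, Rel.cell hV ht hd, key.2⟩, ⟨key.1.symm, Rel.cell hV ht hd, key.2⟩⟩
  | gen_add j a b => exact ⟨map_add _ _ _, qgen j _, qadd (qgen j a) (qgen j b)⟩
  | gen_smul j a b => exact ⟨map_smul _ _ _, qgen j _, qsmul a (qgen j b)⟩
  | gen_bracket h j a b =>
    exact ⟨Hom.app_bracket _ h _ _, qgen j _, qbracket h (qgen j a) (qgen j b)⟩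
  | gen_map f a =>
    exact ⟨congrArg (fun g => Hom.app g _ a) (hu _ _ f), qgen _ _, qgen _ a⟩
  | add_comm _ _ ih ih' =>
    exact ⟨_root_.add_comm _ _, qadd ih.2.1 ih'.2.1, qadd ih'.2.1 ih.2.1⟩
  | add_assoc _ _ _ ih ih' ih'' =>
    exact ⟨_root_.add_assoc _ _ _, qadd (qadd ih.2.1 ih'.2.1) ih''.2.1,
      qadd ih.2.1 (qadd ih'.2.1 ih''.2.1)⟩
  | zero_add _ ih => exact ⟨_root_.zero_add _, qadd (qzero _) ih.2.1, ih.2.1⟩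
  | neg_add _ ih =>
    refine ⟨?_, qadd (qsmul _ ih.2.1) ih.2.1, qzero _⟩
    simp only [Term.eval, neg_smul, _root_.one_smul, neg_add_cancel]
  | smul_add a _ _ ih ih' =>
    exact ⟨_root_.smul_add _ _ _, qsmul a (qadd ih.2.1 ih'.2.1),
      qadd (qsmul a ih.2.1) (qsmul a ih'.2.1)⟩
  | add_smul a b _ ih =>
    exact ⟨_root_.add_smul _ _ _, qsmul _ ih.2.1, qadd (qsmul a ih.2.1) (qsmul b ih.2.1)⟩
  | mul_smul a b _ ih =>
    exact ⟨SemigroupAction.mul_smul _ _ _, qsmul _ ih.2.1, qsmul a (qsmul b ih.2.1)⟩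
  | one_smul _ ih => exact ⟨_root_.one_smul _ _, qsmul _ ih.2.1, ih.2.1⟩
  | add_bracket h _ _ _ ih ih' ih'' =>
    exact ⟨LinearMap.map_add₂ _ _ _ _, qbracket h (qadd ih.2.1 ih'.2.1) ih''.2.1,
      qadd (qbracket h ih.2.1 ih''.2.1) (qbracket h ih'.2.1 ih''.2.1)⟩
  | smul_bracket h a _ _ ih ih' =>
    exact ⟨LinearMap.map_smul₂ _ _ _ _, qbracket h (qsmul a ih.2.1) ih'.2.1,
      qsmul a (qbracket h ih.2.1 ih'.2.1)⟩
  | antisymm h h' _ _ ih ih' =>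
    exact ⟨(X.antisymm _ _ _ h h' _ _).trans (sgn_smul _ _), qbracket h ih.2.1 ih'.2.1,
      qsmul _ (qbracket h' ih'.2.1 ih.2.1)⟩
  | @jacobi i j l _ _ _ _ hqr hrp hpq h₁ h₂ h₃ x y z _ _ _ ih ih' ih'' =>
    refine ⟨?_, qadd (qadd (qbracket h₁ ih.2.1 (qbracket hqr ih'.2.1 ih''.2.1))
      (qsmul _ (qbracket h₂ ih'.2.1 (qbracket hrp ih''.2.1 ih.2.1))))
      (qsmul _ (qbracket h₃ ih''.2.1 (qbracket hpq ih.2.1 ih'.2.1))), qzero _⟩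
    have key := X.jacobi i j l _ _ _ _ hqr hrp hpq h₁ h₂ h₃ (x.eval u c) (y.eval u c)
      (z.eval u c)
    rw [sgn_smul (k := k), sgn_smul (k := k)] at key
    exact key

/-- The morphism from the presented algebra given by the evaluation of expressions. -/
def presented.lift : presented V ⟶ X :=
  homMk
    (fun n =>
      { toFun := _root_.Quotient.lift (fun t : Valid V n => t.1.eval u c)
          fun _ _ h => (Rel.eval_eq p v hu hup hc h).1
        map_add' := by
          rintro ⟨s, hs⟩ ⟨t, ht⟩
          rfl
        map_smul' := by
          rintro a ⟨t, ht⟩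
          rfl })
    (fun n x => by
      obtain ⟨t, ht, rfl⟩ := presented.cls_surjective x
      rw [presented.diff_cls]
      exact (Rel.eval_eq p v hu hup hc ht).2.1.1)
    (fun i j n h x y => by
      obtain ⟨s, hs, rfl⟩ := presented.cls_surjective x
      obtain ⟨t, ht, rfl⟩ := presented.cls_surjective y
      rfl)

theorem presented.lift_comp : presented.lift p v hu hup hc ≫ p = v :=
  hom_ext fun n x => by
    obtain ⟨t, ht, rfl⟩ := presented.cls_surjective x
    exact (Rel.eval_eq p v hu hup hc ht).2.1.2.2

end Lift

end DGLieAlgebra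

namespace DGLieAlgebra

variable {k : Type u} [CommRing k]

open Term

namespace presented

variable {J : Type} [SmallCategory J] {F : J ⥤ DGLieAlgebra k} {Λ : ℤ → Type u}
  {V : ∀ n : ℤ, Term F Λ (n + 1) → Λ n → Prop}

theorem induction {P : ∀ n : ℤ, (presented V).complex.X n → Prop} (zero : ∀ n, P n 0)
    (add : ∀ n x y, P n x → P n y → P n (x + y))
    (smul : ∀ n (c : k) x, P n x → P n (c • x))
    (gen : ∀ n j (a : (F.obj j).complex.X n), P n (Hom.app (incl V j) n a))
    (cell : ∀ n (t : Term F Λ (n + 1)) l (hV : V n t l) (ht : Rel V t t)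
      (hd : Rel V (Term.diff t) Term.zero), P (n + 1) (cls t ht) →
      P n (cls (.cell t l) (Rel.cell hV ht hd)))
    (bracket : ∀ p q n h x y, P p x → P q y → P n ((presented V).bracket p q n h x y))
    {n : ℤ} (x : (presented V).complex.X n) : P n x :=
  Class.induction zero add smul gen cell bracket x

theorem hom_ext {X : DGLieAlgebra k} {f g : presented V ⟶ X}
    (h : ∀ j, incl V j ≫ f = incl V j ≫ g)
    (h' : ∀ n (t : Term F Λ (n + 1)) l (hV : V n t l) (ht : Rel V t t)
      (hd : Rel V (Term.diff t) Term.zero),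
      Hom.app f (n + 1) (cls t ht) = Hom.app g (n + 1) (cls t ht) →
      Hom.app f n (cls (.cell t l) (Rel.cell hV ht hd)) =
        Hom.app g n (cls (.cell t l) (Rel.cell hV ht hd))) : f = g := by
  refine DGLieAlgebra.hom_ext fun n x => ?_
  induction x using presented.induction with
  | zero => simp only [map_zero]
  | add n x y hx hy => simp only [map_add, hx, hy]
  | smul n c x hx => simp only [map_smul, hx]
  | gen n j a => exact congrArg (fun e : F.obj j ⟶ X => Hom.app e n a) (h j)
  | cell n t l hV ht hd ih => exact h' n t l hV ht hd ih
  | bracket p q n h x y hx hy => rw [Hom.app_bracket, Hom.app_bracket, hx, hy]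

end presented

/-! ### Finite colimits -/

section Colimits

open Limits

variable {J : Type} [SmallCategory J] (F : J ⥤ DGLieAlgebra k)

/-- The colimit cocone of a diagram of dg-Lie algebras. -/
def colimitCocone : Cocone F where
  pt := presented (F := F) (Λ := fun _ => PEmpty) (fun _ _ _ => False)
  ι :=
    { app := presented.incl _
      naturality := fun _ _ f => presented.map_incl f }

/-- The colimit cocone is a colimit. -/
def colimitCoconeIsColimit : IsColimit (colimitCocone F) where
  -- Over the zero algebra the conditions on `p` and `v` are vacuous, so that the lift is just a map
  -- out of the colimit.
  desc s := presented.lift (c := fun _ _ _ l => l.elim) (toZeroAlgebra s.pt) (toZeroAlgebra _)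
    (u := s.ι.app) (fun _ _ f => s.w f) (fun _ => rfl) (fun _ _ l => l.elim)
  fac _ _ := rfl
  uniq _ _ hm := presented.hom_ext (fun j => hm j) (fun _ _ l => l.elim)

instance : HasFiniteColimits (DGLieAlgebra k) where
  out _ _ _ := { has_colimit := fun F => ⟨⟨⟨colimitCocone F, colimitCoconeIsColimit F⟩⟩⟩ }

end Colimits

/-! ### Surjective quasi-isomorphisms as an elementwise lifting condition -/

/-- A morphism of dg-Lie algebras which is surjective in each degree. -/
def IsSurjective {L M : DGLieAlgebra k} (f : L ⟶ M) : Prop :=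
  ∀ n, Function.Surjective (Hom.app f n)

/-- Every cocycle of the source which becomes a given coboundary `d y` in the target is itself
the coboundary of an element which maps to `y`. -/
def IsAcyclicFibration {L M : DGLieAlgebra k} (f : L ⟶ M) : Prop :=
  ∀ (n : ℤ) (x : L.complex.X (n + 1)) (y : M.complex.X n), L.diff (n + 1) x = 0 →
    Hom.app f (n + 1) x = M.diff n y → ∃ z, L.diff n z = x ∧ Hom.app f n z = y

theorem IsAcyclicFibration.isSurjective {L M : DGLieAlgebra k} {f : L ⟶ M}
    (h : IsAcyclicFibration f) : IsSurjective f := fun n y => by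
  -- The condition is used twice: with `x = 0` it lifts the cocycle `d y` to a cocycle `z`, and then
  -- with `x = z` it lifts `y`.
  obtain ⟨z, hz, hz'⟩ := h (n + 1) 0 (M.diff n y) (map_zero _)
    ((map_zero _).trans (M.diff_diff n y).symm)
  obtain ⟨w, -, hw⟩ := h n z y hz hz'
  exact ⟨w, hw⟩

/-- The elementwise characterization of the quasi-isomorphisms between dg-Lie algebras. -/
theorem quasiIso_iff {L M : DGLieAlgebra k} (f : L ⟶ M) :
    QuasiIso ((forgetToComplex k).map f) ↔ ∀ n : ℤ,
      (∀ x, L.diff (n + 1) x = 0 → (∃ z, M.diff n z = Hom.app f (n + 1) x) →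
        ∃ z, L.diff n z = x) ∧
      (∀ y, M.diff (n + 1) y = 0 →
        ∃ x, L.diff (n + 1) x = 0 ∧ ∃ z, M.diff n z = Hom.app f (n + 1) x - y) :=
  CochainComplex.quasiIso_iff_forall _

theorem isAcyclicFibration_iff {L M : DGLieAlgebra k} (f : L ⟶ M) :
    IsAcyclicFibration f ↔ IsSurjective f ∧ QuasiIso ((forgetToComplex k).map f) := by
  rw [quasiIso_iff]
  constructor
  · refine fun h => ⟨h.isSurjective, fun n => ⟨fun x hx ⟨y, hy⟩ => ?_, fun y hy => ?_⟩⟩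
    · obtain ⟨z, hz, -⟩ := h n x y hx hy.symm
      exact ⟨z, hz⟩
    · obtain ⟨z, hz, hz'⟩ := h (n + 1) 0 y (map_zero _) ((map_zero _).trans hy.symm)
      refine ⟨z, hz, 0, ?_⟩
      rw [map_zero]
      exact (sub_eq_zero.2 hz').symm
  · rintro ⟨hs, hq⟩ n x y hx hxy
    obtain ⟨m, rfl⟩ : ∃ m, m + 1 = n := ⟨n - 1, by ring⟩
    -- A primitive `x₀` of `x` is corrected by a cocycle `z`, which represents the class of `y - f
    -- x₀`, and by a coboundary `d w`, where `w` lifts the remaining discrepancy by surjectivity.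
    obtain ⟨x₀, hx₀⟩ := (hq (m + 1)).1 x hx ⟨y, hxy.symm⟩
    have hy : M.diff (m + 1) (y - Hom.app f (m + 1) x₀) = 0 := by
      rw [map_sub, ← Hom.app_diff, hx₀, hxy, sub_self]
    obtain ⟨z, hz, w, hw⟩ := (hq m).2 _ hy
    obtain ⟨w, rfl⟩ := hs m w
    refine ⟨x₀ + z - L.diff m w, ?_, ?_⟩
    · rw [map_sub, map_add, hx₀, hz, L.diff_diff, add_zero, sub_zero]
    · rw [map_sub, map_add, Hom.app_diff, hw]
      abel

/-! ### Factorization into a cofibration and an acyclic fibration -/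

section CofibrationFactorization

variable {A B : DGLieAlgebra k} (f : A ⟶ B)

/-- The constant diagram on one dg-Lie algebra. -/
abbrev single (A : DGLieAlgebra k) : Discrete PUnit.{1} ⥤ DGLieAlgebra k :=
  (Functor.const _).obj A

/-- The value in `B` of an expression in the elements of `A` and in generators labelled by the
elements of `B`. -/
def semifreeEval {n : ℤ} (t : Term (single A) (fun n => B.complex.X n) n) : B.complex.X n :=
  t.eval (fun _ => f) (fun _ _ _ b => b)

/-- The semifree extension of `A` obtained by iteratively adding all the generators with which
a cocycle whose image in `B` is a coboundary becomes a coboundary. -/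
def semifree : DGLieAlgebra k :=
  presented (F := single A) (Λ := fun n => B.complex.X n)
    (fun n t b => semifreeEval f t = B.diff n b)

/-- The inclusion of `A` in its semifree extension. -/
def semifreeIncl : A ⟶ semifree f := presented.incl (F := single A) _ ⟨⟨⟩⟩

/-- The projection of the semifree extension. -/
def semifreeProj : semifree f ⟶ B :=
  presented.lift (F := single A) (u := fun _ => f) (c := fun _ _ _ b => b) (toZeroAlgebra B)
    (toZeroAlgebra _) (fun _ _ _ => rfl) (fun _ => rfl)
    (fun _ _ _ hV _ _ _ _ => ⟨hV.symm, Subsingleton.elim _ _⟩)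

theorem semifreeIncl_proj : semifreeIncl f ≫ semifreeProj f = f := rfl

/-- The lifting problem given by a cocycle `t` and by `b` is itself the datum of a generator, `cell
t b`, and this generator solves it. One stage suffices because `t` may already contain cells. -/
theorem semifreeProj_isAcyclicFibration : IsAcyclicFibration (semifreeProj f) := by
  intro n x b hx hb
  obtain ⟨t, ht, rfl⟩ := presented.cls_surjective x
  have hd := presented.rel_of_cls_eq ((presented.diff_cls t ht).symm.trans hx)
  exact ⟨presented.cls (.cell t b) (Rel.cell hb ht hd), presented.diff_cls _ _, rfl⟩

/-- The lift is defined by recursion on expressions: once `t` has a value in `X`, the condition on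
`p` supplies a value of `cell t b` with the prescribed differential and the prescribed image in `Y`.
-/
theorem semifreeIncl_hasLiftingProperty {X Y : DGLieAlgebra k} (p : X ⟶ Y)
    (hp : IsAcyclicFibration p) : HasLiftingProperty (semifreeIncl f) p where
  sq_hasLift := by
    intro u v sq
    classical
    let V : ∀ n, Term (single A) (fun n => B.complex.X n) (n + 1) → B.complex.X n → Prop :=
      fun n t b => semifreeEval f t = B.diff n b
    let c : ∀ n : ℤ, Term (single A) (fun n => B.complex.X n) (n + 1) → X.complex.X (n + 1) →
        B.complex.X n → X.complex.X n := fun n t ξ b =>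
      -- The rule must be defined on meaningless expressions too, so validity is part of the
      -- existence statement; the value 0 is never used on a meaningful cell.
      if h : ∃ (z : X.complex.X n) (hz : Rel V (.cell t b) (.cell t b)), X.diff n z = ξ ∧
        Hom.app p n z = Hom.app v n (presented.cls (.cell t b) hz) then h.choose else 0
    have hc : ∀ n (t : Term (single A) (fun n => B.complex.X n) (n + 1)) b (hV : V n t b)
        (ht : Rel V t t) (hd : Rel V t.diff .zero),
        X.diff (n + 1) (t.eval (fun _ => u) c) = 0 →
        Hom.app p (n + 1) (t.eval (fun _ => u) c) = Hom.app v (n + 1) (presented.cls t ht) →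
        X.diff n (c n t (t.eval (fun _ => u) c) b) = t.eval (fun _ => u) c ∧
          Hom.app p n (c n t (t.eval (fun _ => u) c) b) =
            Hom.app v n (presented.cls (.cell t b) (Rel.cell hV ht hd)) := by
      intro n t b hV ht hd h₁ h₂
      have h : ∃ (z : X.complex.X n) (hz : Rel V (.cell t b) (.cell t b)),
          X.diff n z = t.eval (fun _ => u) c ∧
          Hom.app p n z = Hom.app v n (presented.cls (.cell t b) hz) := by
        obtain ⟨z, hz, hz'⟩ := hp n (t.eval (fun _ => u) c)
          (Hom.app v n (presented.cls (.cell t b) (Rel.cell hV ht hd))) h₁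
          (h₂.trans ((congrArg (Hom.app v (n + 1))
            (presented.diff_cls (.cell t b) (Rel.cell hV ht hd)).symm).trans
            (Hom.app_diff v n _)))
        exact ⟨z, Rel.cell hV ht hd, hz, hz'⟩
      have hcz : c n t (t.eval (fun _ => u) c) b = h.choose := dif_pos h
      rw [hcz]
      obtain ⟨_, h₃⟩ := h.choose_spec
      exact h₃
    exact ⟨⟨{ l := presented.lift (F := single A) (V := V) p v (u := fun _ => u) (c := c)
                (fun _ _ _ => Category.id_comp _) (fun _ => sq.w) hc
              fac_left := rfl
              fac_right := presented.lift_comp (F := single A) (V := V) p v (u := fun _ => u)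
                (c := c) (fun _ _ _ => Category.id_comp _) (fun _ => sq.w) hc }⟩⟩

end CofibrationFactorization

end DGLieAlgebra

namespace DGLieAlgebra

variable {k : Type u} [CommRing k]

open Term

/-! ### Weights, and a criterion for an extension to be a quasi-isomorphism -/

section Homotopy

variable {A W : DGLieAlgebra k} (ι : A ⟶ W)
  (h : ∀ m n : ℤ, m + -1 = n → (W.complex.X m →ₗ[k] W.complex.X n))

/-- The anticommutator of the differential and of a family of maps of degree `-1`. -/
def eulerMap (n : ℤ) : W.complex.X n →ₗ[k] W.complex.X n :=
  (W.complex.d (n + -1) n).hom ∘ₗ h n (n + -1) rfl + h (n + 1) n (by lia) ∘ₗ W.diff n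

theorem eulerMap_apply (n : ℤ) (x : W.complex.X n) :
    eulerMap h n x =
      (W.complex.d (n + -1) n).hom (h n (n + -1) rfl x) + h (n + 1) n (by lia) (W.diff n x) :=
  rfl

variable {h}

/-- If `h` is a derivation of degree `-1`, then `d h + h d` is a derivation of degree `0`. -/
theorem eulerMap_bracket
    (hb : ∀ (p p' q q' n n' : ℤ) (hp : p + -1 = p') (hq : q + -1 = q') (hn : n + -1 = n')
      (hpq : p + q = n) (h₁ : p' + q = n') (h₂ : p + q' = n') (x : W.complex.X p)
      (y : W.complex.X q), h n n' hn (W.bracket p q n hpq x y) =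
        W.bracket p' q n' h₁ (h p p' hp x) y + sgn k p • W.bracket p q' n' h₂ x (h q q' hq y))
    {p q n : ℤ} (hpq : p + q = n) (x : W.complex.X p) (y : W.complex.X q) :
    eulerMap h n (W.bracket p q n hpq x y) =
      W.bracket p q n hpq (eulerMap h p x) y + W.bracket p q n hpq x (eulerMap h q y) := by
  have e₁ : p + -1 + q = n + -1 := by omega
  have e₂ : p + (q + -1) = n + -1 := by omega
  have e₃ : p + 1 + q = n + 1 := by omega
  have e₄ : p + (q + 1) = n + 1 := by omega
  have e₅ : p + -1 + (q + 1) = n := by omega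
  have e₆ : p + 1 + (q + -1) = n := by omega
  have c₁ (i : ℤ) : i + -1 + 1 = i := by omega
  have c₂ (i : ℤ) : i + 1 + -1 = i := by omega
  have k₁ := W.leibniz (p + -1) p q (q + 1) (n + -1) n (c₁ p) rfl (c₁ n) e₁ hpq e₅
    (h p (p + -1) rfl x) y
  have k₂ := W.leibniz p (p + 1) (q + -1) q (n + -1) n rfl (c₁ q) (c₁ n) e₂ e₆ hpq
    x (h q (q + -1) rfl y)
  have k₃ := hb (p + 1) p q (q + -1) (n + 1) n (c₂ p) rfl (c₂ n) e₃ hpq e₆ (W.diff p x) y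
  have k₄ := hb p (p + -1) (q + 1) q (n + 1) n rfl (c₂ q) (c₂ n) e₄ e₅ hpq x (W.diff q y)
  rw [eulerMap_apply, hb p (p + -1) q (q + -1) n (n + -1) rfl rfl rfl hpq e₁ e₂,
    W.leibniz p (p + 1) q (q + 1) n (n + 1) rfl rfl rfl hpq e₃ e₄, map_add, map_smul, k₁, k₂,
    sgn_smul (k := k), sgn_smul (k := k), sgn_smul (k := k), map_add, map_smul, k₃, k₄,
    eulerMap_apply, eulerMap_apply, map_add, map_add, LinearMap.add_apply]
  -- The mixed terms `[h x, d y]` and `[d x, h y]` each occur twice, with opposite signs, since `p ±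
  -- 1` and `p` have opposite parity.
  simp only [sgn_eq, Int.even_add, even_neg, Int.not_even_one, iff_false]
  by_cases hp : Even p <;> simp [hp] <;> abel

variable (h) in
/-- The elements of degree `n` which come from `A` or have a positive weight, where the weight
is the eigenvalue of `d h + h d`. -/
def weightVectors (n : ℤ) : Set (W.complex.X n) :=
  {x | (∃ a, Hom.app ι n a = x) ∨ ∃ i : ℕ, eulerMap h n x = ((i : k) + 1) • x}

variable {ι}

/-- Weights add under the bracket, with `A` in weight 0. The index `i` stands for the weight `i +
1`, whence `i + j + 1` for a bracket of two positive weights. -/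
theorem bracket_mem_span_weightVectors
    (hb : ∀ (p q n : ℤ) (hpq : p + q = n) (x : W.complex.X p) (y : W.complex.X q),
      eulerMap h n (W.bracket p q n hpq x y) =
        W.bracket p q n hpq (eulerMap h p x) y + W.bracket p q n hpq x (eulerMap h q y))
    (hι : ∀ n a, eulerMap h n (Hom.app ι n a) = 0) {p q n : ℤ} (hpq : p + q = n)
    {x : W.complex.X p} {y : W.complex.X q} (hx : x ∈ Submodule.span k (weightVectors ι h p))
    (hy : y ∈ Submodule.span k (weightVectors ι h q)) :
    W.bracket p q n hpq x y ∈ Submodule.span k (weightVectors ι h n) := by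
  have key := Submodule.apply_mem_map₂ (W.bracket p q n hpq) hx hy
  rw [Submodule.map₂_span_span] at key
  refine Submodule.span_mono ?_ key
  rintro _ ⟨x, hx, y, hy, rfl⟩
  obtain ⟨a, rfl⟩ | ⟨i, hi⟩ := hx
  · obtain ⟨b, rfl⟩ | ⟨j, hj⟩ := hy
    · exact Or.inl ⟨_, Hom.app_bracket ι hpq a b⟩
    · refine Or.inr ⟨j, ?_⟩
      simp only [hb, hι, hj, map_zero, LinearMap.zero_apply, map_smul, zero_add]
  · obtain ⟨b, rfl⟩ | ⟨j, hj⟩ := hy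
    · refine Or.inr ⟨i, ?_⟩
      simp only [hb, hι, hi, map_zero, map_smul, LinearMap.smul_apply, add_zero]
    · refine Or.inr ⟨i + j + 1, ?_⟩
      simp only [hb, hi, hj, map_smul, LinearMap.smul_apply, ← add_smul]
      congr 1
      push_cast
      ring

variable (h) in
/-- The product of the operators `d h + h d - i`, for `i = 1, …, N`. -/
def weightKiller (n : ℤ) : ℕ → (W.complex.X n →ₗ[k] W.complex.X n)
  | 0 => LinearMap.id
  | N + 1 => weightKiller n N ∘ₗ (eulerMap h n - ((N : k) + 1) • LinearMap.id)

theorem weightKiller_succ (n : ℤ) (N : ℕ) (x : W.complex.X n) :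
    weightKiller h n (N + 1) x = weightKiller h n N (eulerMap h n x - ((N : k) + 1) • x) :=
  rfl

theorem weightKiller_of_weight {n : ℤ} {x : W.complex.X n} {i : ℕ}
    (hx : eulerMap h n x = ((i : k) + 1) • x) {N : ℕ} (hN : i < N) :
    weightKiller h n N x = 0 := by
  induction N with
  | zero => exact absurd hN (Nat.not_lt_zero i)
  | succ N ih =>
    rw [weightKiller_succ, hx, ← sub_smul, map_smul]
    obtain hlt | rfl := Nat.lt_succ_iff_lt_or_eq.1 hN
    · rw [ih hlt, smul_zero]
    · rw [sub_self, zero_smul]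

/-- On the image of `A` the operator `d h + h d` is zero, so each factor acts there as a scalar. -/
theorem weightKiller_app (hι : ∀ n a, eulerMap h n (Hom.app ι n a) = 0) {n : ℤ}
    (a : A.complex.X n) (N : ℕ) : ∃ b, Hom.app ι n b = weightKiller h n N (Hom.app ι n a) := by
  induction N generalizing a with
  | zero => exact ⟨a, rfl⟩
  | succ N ih =>
    obtain ⟨b, hb⟩ := ih (-((N : k) + 1) • a)
    refine ⟨b, hb.trans ?_⟩
    rw [weightKiller_succ, hι, zero_sub, map_smul, neg_smul]

/-- A large enough product kills the finitely many positive weights that occur in `x` and leaves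
only a contribution of `A`. Asking for all `M ≥ N` lets the bounds of two summands be merged. -/
theorem exists_weightKiller_mem (hι : ∀ n a, eulerMap h n (Hom.app ι n a) = 0) {n : ℤ}
    {x : W.complex.X n} (hx : x ∈ Submodule.span k (weightVectors ι h n)) :
    ∃ N, ∀ M, N ≤ M → ∃ b, Hom.app ι n b = weightKiller h n M x := by
  induction hx using Submodule.span_induction with
  | mem x hx =>
    obtain ⟨a, rfl⟩ | ⟨i, hi⟩ := hx
    · exact ⟨0, fun M _ => weightKiller_app hι a M⟩
    · exact ⟨i + 1, fun M hM => ⟨0, by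
        rw [map_zero, weightKiller_of_weight hi (Nat.lt_of_succ_le hM)]⟩⟩
  | zero => exact ⟨0, fun M _ => ⟨0, by rw [map_zero, map_zero]⟩⟩
  | add x y _ _ ihx ihy =>
    obtain ⟨N, hN⟩ := ihx
    obtain ⟨N', hN'⟩ := ihy
    refine ⟨max N N', fun M hM => ?_⟩
    obtain ⟨b, hb⟩ := hN M (le_of_max_le_left hM)
    obtain ⟨b', hb'⟩ := hN' M (le_of_max_le_right hM)
    exact ⟨b + b', by rw [map_add, map_add, hb, hb']⟩
  | smul c x _ ih =>
    obtain ⟨N, hN⟩ := ih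
    refine ⟨N, fun M hM => ?_⟩
    obtain ⟨b, hb⟩ := hN M hM
    exact ⟨c • b, by rw [map_smul, map_smul, hb]⟩

/-- The one place where the `ℚ`-algebra structure does its work: positive weights are invertible. -/
theorem exists_mul_natCast_succ_eq_one [Algebra ℚ k] (N : ℕ) : ∃ c : k, c * ((N : k) + 1) = 1 := by
  refine ⟨algebraMap ℚ k ((N : ℚ) + 1)⁻¹, ?_⟩
  rw [← map_natCast (algebraMap ℚ k) N, ← map_one (algebraMap ℚ k), ← map_add, ← map_mul,
    inv_mul_cancel₀ (Nat.cast_add_one_ne_zero N)]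

/-- On a cocycle, `E = d h + h d` reduces to `d h`, so subtracting a multiple of `E x` does not
change the cohomology class. Factors of the product are removed in this way one by one, without a
decomposition into eigenspaces. -/
theorem cocycle_of_weightKiller_mem [Algebra ℚ k] {m n : ℤ} (hmn : m + 1 = n) (N : ℕ)
    (x : W.complex.X n) (hx : W.diff n x = 0)
    (hN : ∃ b, Hom.app ι n b = weightKiller h n N x) :
    ∃ a z, Hom.app ι n a = x + (W.complex.d m n).hom z := by
  obtain rfl : m = n + -1 := by lia
  induction N generalizing x with
  | zero =>
    obtain ⟨b, hb⟩ := hN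
    exact ⟨b, 0, by rw [map_zero, add_zero, hb]; rfl⟩
  | succ N ih =>
    obtain ⟨c, hc⟩ := exists_mul_natCast_succ_eq_one (k := k) N
    have hE : eulerMap h n x = (W.complex.d (n + -1) n).hom (h n (n + -1) rfl x) := by
      rw [eulerMap_apply, hx, map_zero, add_zero]
    -- With `c = 1 / (N + 1)`, this element is `-c (E - (N + 1)) x`, so the product of `N` factors
    -- sends it to `-c` times what `N + 1` factors make of `x`.
    obtain ⟨a, z, hz⟩ := ih (x - c • eulerMap h n x) (by
        have hdd := ConcreteCategory.congr_hom (W.complex.d_comp_d (n + -1) n (n + 1))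
          (h n (n + -1) rfl x)
        rw [ConcreteCategory.comp_apply] at hdd
        rw [map_sub, map_smul, hx, hE]
        exact (congrArg (fun w => 0 - c • w) hdd).trans (by simp)) (by
        obtain ⟨b, hb⟩ := hN
        refine ⟨-c • b, ?_⟩
        rw [map_smul, hb, weightKiller_succ, ← map_smul]
        congr 1
        rw [smul_sub, smul_smul, neg_mul, hc]
        module)
    refine ⟨a, z - c • h n (n + -1) rfl x, ?_⟩
    rw [hz, map_sub, map_smul, hE]
    abel

/-- An extension of dg-Lie algebras over a `ℚ`-algebra is a quasi-isomorphism if it has a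
retraction and is spanned, outside of the image, by elements of positive weight. -/
theorem quasiIso_of_weightVectors [Algebra ℚ k] (r : W ⟶ A) (hr : ι ≫ r = 𝟙 A)
    (hι : ∀ n a, eulerMap h n (Hom.app ι n a) = 0)
    (hspan : ∀ n (x : W.complex.X n), x ∈ Submodule.span k (weightVectors ι h n)) :
    QuasiIso ((forgetToComplex k).map ι) := by
  have hr' : ∀ n a, Hom.app r n (Hom.app ι n a) = a := fun n a =>
    congrArg (fun f : A ⟶ A => Hom.app f n a) hr
  refine (quasiIso_iff ι).2 fun n => ⟨fun x _ ⟨z, hz⟩ => ⟨Hom.app r n z, ?_⟩, fun y hy => ?_⟩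
  · rw [← Hom.app_diff, hz, hr']
  · obtain ⟨N, hN⟩ := exists_weightKiller_mem hι (hspan _ y)
    obtain ⟨a, z, hz⟩ := cocycle_of_weightKiller_mem (m := n) rfl N y hy (hN N le_rfl)
    refine ⟨a, ?_, z, ?_⟩
    -- The image of `a` is a cocycle, and the retraction reflects this to `a`.
    · rw [← hr' _ (A.diff (n + 1) a), Hom.app_diff, hz, map_add, hy, W.diff_diff, add_zero,
        map_zero]
    · rw [hz, add_sub_cancel_left]

end Homotopy

/-! ### Extensions by free contractible pairs of generators -/

section ContractibleExtension

variable (A : DGLieAlgebra k) (S : ℤ → Type u)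

/-- The condition on the generators of the contractible extension: for `s : S m`, a generator
of degree `m + 1` with zero differential, and a generator of degree `m` of which the former is
the differential. -/
def contractibleCondition (n : ℤ) (t : Term (single A) (fun _ => Σ m, S m) (n + 1))
    (l : Σ m, S m) : Prop :=
  (l.1 = n ∧ t = .cell .zero l) ∨ (l.1 + 1 = n ∧ t = .zero)

/-- The extension of a dg-Lie algebra by free generators `x_s` and `d x_s`, for `s` in a graded
set. -/
def contractibleExtension : DGLieAlgebra k := presented (contractibleCondition A S)

namespace contractibleExtension

variable {A S}

theorem rel_boundary {n : ℤ} (l : Σ m, S m) (hl : l.1 + 1 = n) :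
    Rel (contractibleCondition A S) (.cell .zero l : Term _ _ n) (.cell .zero l) :=
  Rel.cell (Or.inr ⟨hl, rfl⟩) Rel.zero Rel.zero

theorem rel_generator {n : ℤ} (l : Σ m, S m) (hl : l.1 = n) :
    Rel (contractibleCondition A S) (.cell (.cell .zero l) l : Term _ _ n)
      (.cell (.cell .zero l) l) :=
  Rel.cell (Or.inl ⟨hl, rfl⟩) (rel_boundary l (by lia)) Rel.zero

variable (A) in
/-- The generator `x_s` of the contractible extension. -/
def generator {n : ℤ} (l : Σ m, S m) (hl : l.1 = n) : (contractibleExtension A S).complex.X n :=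
  presented.cls _ (rel_generator l hl)

variable (A) in
/-- The generator `d x_s` of the contractible extension. -/
def boundary {n : ℤ} (l : Σ m, S m) (hl : l.1 + 1 = n) :
    (contractibleExtension A S).complex.X n :=
  presented.cls _ (rel_boundary l hl)

variable (A S) in
/-- The inclusion in the contractible extension. -/
def incl : A ⟶ contractibleExtension A S := presented.incl (F := single A) _ ⟨⟨⟩⟩

/-- The extension is free on the `x_s`: a map out of it is a map out of `A` and an arbitrary choice
of images of the `x_s`, since the image of `d x_s` is forced. -/
theorem exists_lift {X Y : DGLieAlgebra k} (p : X ⟶ Y) (u : A ⟶ X)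
    (v : contractibleExtension A S ⟶ Y) (huv : u ≫ p = incl A S ≫ v)
    (g : ∀ m, S m → X.complex.X m)
    (hg : ∀ m s, Hom.app p m (g m s) = Hom.app v m (generator A ⟨m, s⟩ rfl)) :
    ∃ w : contractibleExtension A S ⟶ X, incl A S ≫ w = u ∧ w ≫ p = v ∧
      ∀ m s, Hom.app w m (generator A ⟨m, s⟩ rfl) = g m s := by
  let c : ∀ n : ℤ, Term (single A) (fun _ => Σ m, S m) (n + 1) → X.complex.X (n + 1) →
      (Σ m, S m) → X.complex.X n := fun n _ _ l =>
    -- The degree tells `x_s`, in degree `m`, from `d x_s`, in degree `m + 1`. In any other degree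
    -- the differential is zero and the label gives no generator.
    if hl : l.1 = n then hl ▸ g l.1 l.2 else (X.complex.d l.1 n).hom (g l.1 l.2)
  have hc₁ : ∀ (m : ℤ) (s : S m) t ξ, c m t ξ ⟨m, s⟩ = g m s := fun m s t ξ => dif_pos rfl
  have hc₂ : ∀ (m : ℤ) (s : S m) t ξ, c (m + 1) t ξ ⟨m, s⟩ = X.diff m (g m s) :=
    fun m s t ξ => dif_neg (show ¬ m = m + 1 by lia)
  clear_value c
  have hc : ∀ n (t : Term (single A) (fun _ => Σ m, S m) (n + 1)) (l : Σ m, S m)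
      (hV : contractibleCondition A S n t l) (ht : Rel (contractibleCondition A S) t t)
      (hd : Rel (contractibleCondition A S) t.diff .zero),
      X.diff (n + 1) (t.eval (fun _ => u) c) = 0 →
      Hom.app p (n + 1) (t.eval (fun _ => u) c) = Hom.app v (n + 1) (presented.cls t ht) →
      X.diff n (c n t (t.eval (fun _ => u) c) l) = t.eval (fun _ => u) c ∧
        Hom.app p n (c n t (t.eval (fun _ => u) c) l) =
          Hom.app v n (presented.cls (.cell t l) (Rel.cell hV ht hd)) := by
    rintro n t ⟨m, s⟩ hV ht hd - -
    obtain ⟨hl, rfl⟩ | ⟨hl, rfl⟩ := id hV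
    · change m = n at hl
      subst hl
      rw [hc₁]
      exact ⟨(hc₂ m s .zero 0).symm, hg m s⟩
    · change m + 1 = n at hl
      subst hl
      rw [hc₂]
      refine ⟨X.diff_diff m _, ?_⟩
      rw [Hom.app_diff, hg, ← Hom.app_diff]
      exact congrArg (Hom.app v (m + 1)) (presented.diff_cls _ _)
  refine ⟨presented.lift (F := single A) (u := fun _ => u) (c := c) p v
    (fun _ _ _ => Category.id_comp _) (fun _ => huv) hc, rfl,
    presented.lift_comp (F := single A) (u := fun _ => u) (c := c) p v
    (fun _ _ _ => Category.id_comp _) (fun _ => huv) hc, fun m s => hc₁ m s _ _⟩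

theorem incl_hasLiftingProperty {X Y : DGLieAlgebra k} (p : X ⟶ Y) (hp : IsSurjective p) :
    HasLiftingProperty (incl A S) p where
  sq_hasLift := by
    intro u v sq
    choose g hg using fun (m : ℤ) (s : S m) => hp m (Hom.app v m (generator A ⟨m, s⟩ rfl))
    obtain ⟨w, hw, hw', -⟩ := exists_lift p u v sq.w g hg
    exact ⟨⟨{ l := w, fac_left := hw, fac_right := hw' }⟩⟩

theorem exists_desc {X : DGLieAlgebra k} (u : A ⟶ X) (g : ∀ m, S m → X.complex.X m) :
    ∃ w : contractibleExtension A S ⟶ X, incl A S ≫ w = u ∧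
      ∀ m s, Hom.app w m (generator A ⟨m, s⟩ rfl) = g m s := by
  obtain ⟨w, hw, -, hw'⟩ := exists_lift (toZeroAlgebra X) u
    (toZeroAlgebra (contractibleExtension A S)) rfl g (fun _ _ => Subsingleton.elim _ _)
  exact ⟨w, hw, hw'⟩

/-- The derivation of degree `-1` which maps `d x_s` to `x_s`, on generators. -/
def homotopyCell (n : ℤ) (_ : Term (single A) (fun _ => Σ m, S m) (n + 1)) (l : Σ m, S m) :
    Term (single A) (fun _ => Σ m, S m) (n + -1) :=
  if l.1 + 1 = n then .cell (.cell .zero l) l else .zero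

theorem rel_homotopy {n : ℤ} {s t : Term (single A) (fun _ => Σ m, S m) n}
    (h : Rel (contractibleCondition A S) s t) :
    Rel (contractibleCondition A S) (der (-1) (fun _ _ _ => .zero) homotopyCell s)
      (der (-1) (fun _ _ _ => .zero) homotopyCell t) := by
  refine Rel.der (fun _ _ _ => Rel.zero) (fun _ _ _ _ => (Rel.zero_add Rel.zero).symm)
    (fun n _ c _ => ?_) (fun p q n h h₁ h₂ j a b => ?_) (fun _ _ _ _ _ => Rel.zero)
    (fun n t l _ _ _ => ?_) h
  · exact _root_.Quotient.exact
      (smul_zero c : c • (0 : Class (contractibleCondition A S) (n + -1)) = 0).symm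
  · have key (x : Class (contractibleCondition A S) p) (y : Class (contractibleCondition A S) q) :
        0 = Class.bracket (p + -1) q (n + -1) h₁ 0 y
          + sgn k (-1 * p) • Class.bracket p (q + -1) (n + -1) h₂ x 0 := by
      simp only [map_zero, LinearMap.zero_apply, smul_zero, add_zero]
    exact _root_.Quotient.exact (key (Term.mk _ (Rel.gen j a)) (Term.mk _ (Rel.gen j b)))
  · unfold homotopyCell
    split_ifs with hl
    · exact rel_generator l (by lia)
    · exact Rel.zero

/-- The derivation of degree `-1` of the contractible extension which maps `d x_s` to `x_s` and
is zero on the generators `x_s` and on `A`. -/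
def homotopy (m n : ℤ) (h : m + -1 = n) :
    (contractibleExtension A S).complex.X m →ₗ[k] (contractibleExtension A S).complex.X n :=
  h ▸ Class.derMap (V := contractibleCondition A S) rel_homotopy m

theorem homotopy_bracket (p p' q q' n n' : ℤ) (hp : p + -1 = p') (hq : q + -1 = q')
    (hn : n + -1 = n') (hpq : p + q = n) (h₁ : p' + q = n') (h₂ : p + q' = n')
    (x : (contractibleExtension A S).complex.X p) (y : (contractibleExtension A S).complex.X q) :
    homotopy n n' hn ((contractibleExtension A S).bracket p q n hpq x y) =
      (contractibleExtension A S).bracket p' q n' h₁ (homotopy p p' hp x) y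
        + sgn k p • (contractibleExtension A S).bracket p q' n' h₂ x (homotopy q q' hq y) := by
  subst hp hq hn
  have hs : sgn k p = sgn k (-1 * p) := by simp [sgn_eq]
  rw [hs]
  exact Class.derMap_bracket (V := contractibleCondition A S) rel_homotopy hpq h₁ h₂ x y

theorem homotopy_incl {m n : ℤ} (h : m + -1 = n) (a : A.complex.X m) :
    homotopy m n h (Hom.app (incl A S) m a) = 0 := by
  subst h
  rfl

theorem homotopy_boundary {m n : ℤ} (h : m + -1 = n) (l : Σ m, S m) (hl : l.1 + 1 = m) :
    homotopy m n h (boundary A l hl) =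
      generator A l (by lia) := by
  subst h
  refine presented.cls_eq (V := contractibleCondition A S) (s := homotopyCell m .zero l) ?_
  rw [homotopyCell, if_pos hl]
  exact rel_generator l (by lia)

theorem homotopy_generator {m n : ℤ} (h : m + -1 = n) (l : Σ m, S m) (hl : l.1 = m) :
    homotopy m n h (generator A l hl) = 0 := by
  subst h
  refine presented.cls_eq (V := contractibleCondition A S)
    (s := homotopyCell m (.cell .zero l) l) (t := .zero) ?_
  rw [homotopyCell, if_neg (by lia)]
  exact Rel.zero

theorem d_generator {m n : ℤ} (h : m + 1 = n) (l : Σ m, S m) (hl : l.1 = m) :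
    ((contractibleExtension A S).complex.d m n).hom
      (generator A l hl) =
      boundary A l (by lia) := by
  subst h
  exact presented.diff_cls _ _

theorem diff_boundary {n : ℤ} (l : Σ m, S m) (hl : l.1 + 1 = n) :
    (contractibleExtension A S).diff n (boundary A l hl) = 0 :=
  presented.diff_cls _ _

theorem eulerMap_incl (n : ℤ) (a : A.complex.X n) :
    eulerMap homotopy n (Hom.app (incl A S) n a) = 0 := by
  rw [eulerMap_apply, homotopy_incl, map_zero, ← Hom.app_diff, homotopy_incl, add_zero]

theorem eulerMap_generator {n : ℤ} (l : Σ m, S m) (hl : l.1 = n) :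
    eulerMap homotopy n (generator A l hl) = generator A l hl := by
  rw [eulerMap_apply, homotopy_generator, map_zero, zero_add, d_generator rfl,
    homotopy_boundary]

theorem eulerMap_boundary {n : ℤ} (l : Σ m, S m) (hl : l.1 + 1 = n) :
    eulerMap homotopy n (boundary A l hl) = boundary A l hl := by
  rw [eulerMap_apply, diff_boundary, map_zero, add_zero, homotopy_boundary,
    d_generator (by omega)]

/-- Both kinds of new generators have weight 1, which is the index `0`; brackets are covered by the
additivity of weights. -/
theorem mem_span_weightVectors {n : ℤ} (x : (contractibleExtension A S).complex.X n) :
    x ∈ Submodule.span k (weightVectors (incl A S) homotopy n) := by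
  induction x using presented.induction with
  | zero => exact Submodule.zero_mem _
  | add n x y hx hy => exact Submodule.add_mem _ hx hy
  | smul n c x hx => exact Submodule.smul_mem _ c hx
  | gen n j a => exact Submodule.subset_span (Or.inl ⟨a, rfl⟩)
  | cell n t l hV ht hd _ =>
    refine Submodule.subset_span (Or.inr ⟨0, ?_⟩)
    rw [Nat.cast_zero, zero_add]
    refine Eq.trans ?_ (one_smul k _).symm
    obtain ⟨hl, rfl⟩ | ⟨hl, rfl⟩ := id hV
    · exact eulerMap_generator l hl
    · exact eulerMap_boundary l hl
  | bracket p q n h x y hx hy =>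
    exact bracket_mem_span_weightVectors
      (fun p q n hpq x y => eulerMap_bracket homotopy_bracket hpq x y) eulerMap_incl h hx hy

theorem incl_quasiIso [Algebra ℚ k] : QuasiIso ((forgetToComplex k).map (incl A S)) := by
  obtain ⟨r, hr, -⟩ := exists_desc (S := S) (𝟙 A) (fun _ _ => 0)
  exact quasiIso_of_weightVectors r hr eulerMap_incl fun _ => mem_span_weightVectors

end contractibleExtension

end ContractibleExtension

end DGLieAlgebra

namespace DGLieAlgebra

/-! ### Verification of the model category axioms -/

section ModelStructure

variable (k : Type u) [CommRing k]

open MorphismProperty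

/-- The fibrations are the morphisms which are surjective in each degree. -/
abbrev withFibrations : CategoryWithFibrations (DGLieAlgebra k) where
  fibrations := fun _ _ f => IsSurjective f

/-- The weak equivalences are the quasi-isomorphisms. -/
abbrev withWeakEquivalences : CategoryWithWeakEquivalences (DGLieAlgebra k) where
  weakEquivalences :=
    (HomologicalComplex.quasiIso (ModuleCat.{u} k) (ComplexShape.up ℤ)).inverseImage
      (forgetToComplex k)

/-- The cofibrations are the morphisms with the left lifting property with respect to the
fibrations which are weak equivalences. -/
abbrev withCofibrations : CategoryWithCofibrations (DGLieAlgebra k) where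
  cofibrations := llp (fun _ _ f => IsAcyclicFibration f)

attribute [local instance] withFibrations withWeakEquivalences withCofibrations

variable {k}

theorem weakEquivalences_iff {L M : DGLieAlgebra k} (f : L ⟶ M) :
    weakEquivalences (DGLieAlgebra k) f ↔ QuasiIso ((forgetToComplex k).map f) :=
  Iff.rfl

instance : (weakEquivalences (DGLieAlgebra k)).HasTwoOutOfThreeProperty :=
  inferInstanceAs ((HomologicalComplex.quasiIso (ModuleCat.{u} k)
    (ComplexShape.up ℤ)).inverseImage (forgetToComplex k)).HasTwoOutOfThreeProperty

instance : (weakEquivalences (DGLieAlgebra k)).IsStableUnderRetracts :=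
  inferInstanceAs ((HomologicalComplex.quasiIso (ModuleCat.{u} k)
    (ComplexShape.up ℤ)).inverseImage (forgetToComplex k)).IsStableUnderRetracts

instance : (fibrations (DGLieAlgebra k)).IsStableUnderRetracts where
  of_retract {X Y Z W f g} h hg n y := by
    obtain ⟨x, hx⟩ := hg n (Hom.app h.i.right n y)
    refine ⟨Hom.app h.r.left n x, ?_⟩
    have h₁ := congrArg (fun e : Z ⟶ Y => Hom.app e n x) h.r_w
    have h₂ := congrArg (fun e : Y ⟶ Y => Hom.app e n y) h.retract_right
    exact h₁.trans ((congrArg (Hom.app h.r.right n) hx).trans h₂)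

instance : (cofibrations (DGLieAlgebra k)).IsStableUnderRetracts :=
  llp_isStableUnderRetracts _

instance : HasFactorization (cofibrations (DGLieAlgebra k))
    (trivialFibrations (DGLieAlgebra k)) where
  nonempty_mapFactorizationData f :=
    ⟨{ Z := semifree f
       i := semifreeIncl f
       p := semifreeProj f
       fac := semifreeIncl_proj f
       hi := fun _ _ p hp => semifreeIncl_hasLiftingProperty f p hp
       hp := (isAcyclicFibration_iff _).1 (semifreeProj_isAcyclicFibration f) }⟩

instance : IsWeakFactorizationSystem (cofibrations (DGLieAlgebra k))
    (trivialFibrations (DGLieAlgebra k)) :=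
  IsWeakFactorizationSystem.mk' _ _ fun _ p hi hp => hi p ((isAcyclicFibration_iff p).2 hp)

/-- Every morphism over a `ℚ`-algebra factors as a quasi-isomorphism with the left lifting
property with respect to all surjective morphisms, followed by a surjective morphism. -/
theorem exists_factorization [Algebra ℚ k] {L M : DGLieAlgebra k} (f : L ⟶ M) :
    ∃ (N : DGLieAlgebra k) (i : L ⟶ N) (p : N ⟶ M), i ≫ p = f ∧
      QuasiIso ((forgetToComplex k).map i) ∧
      (∀ {X Y : DGLieAlgebra k} (q : X ⟶ Y), IsSurjective q → HasLiftingProperty i q) ∧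
      IsSurjective p := by
  -- One generator for each homogeneous element of `M`, sent to that element, makes `p` surjective.
  obtain ⟨p, hp, hp'⟩ := contractibleExtension.exists_desc (S := fun n => M.complex.X n) f
    (fun _ s => s)
  exact ⟨_, contractibleExtension.incl L _, p, hp, contractibleExtension.incl_quasiIso,
    fun q hq => contractibleExtension.incl_hasLiftingProperty q hq, fun n y => ⟨_, hp' n y⟩⟩

instance [Algebra ℚ k] : HasFactorization (trivialCofibrations (DGLieAlgebra k))
    (fibrations (DGLieAlgebra k)) where
  nonempty_mapFactorizationData f := by
    obtain ⟨N, i, p, fac, hi, hi', hp⟩ := exists_factorization f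
    exact ⟨{ Z := N
             i := i
             p := p
             fac := fac
             hi := ⟨fun _ _ q hq => hi' q hq.isSurjective, hi⟩
             hp := hp }⟩

/-- The retract argument: factor `i` as `j` followed by a surjection `q`. By two-out-of-three `q` is
acyclic, so `i` lifts against `q` and is a retract of `j`, which lifts against all surjections. -/
theorem hasLiftingProperty_of_trivialCofibration [Algebra ℚ k] {A B X Y : DGLieAlgebra k}
    (i : A ⟶ B) (p : X ⟶ Y) (hi : trivialCofibrations (DGLieAlgebra k) i) (hp : IsSurjective p) :
    HasLiftingProperty i p := by
  obtain ⟨N, j, q, fac, hj, hj', hq⟩ := exists_factorization i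
  have hqw : weakEquivalences (DGLieAlgebra k) q :=
    (weakEquivalences (DGLieAlgebra k)).of_precomp j q
      ((weakEquivalences_iff j).2 hj) (by rw [fac]; exact hi.2)
  have := hi.1 q ((isAcyclicFibration_iff q).2 ⟨hq, hqw⟩)
  have := hj' p hp
  have sq : CommSq j i q (𝟙 B) := ⟨by rw [fac, Category.comp_id]⟩
  exact (RetractArrow.ofLeftLiftingProperty fac).leftLiftingProperty p

instance [Algebra ℚ k] : IsWeakFactorizationSystem (trivialCofibrations (DGLieAlgebra k))
    (fibrations (DGLieAlgebra k)) :=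
  IsWeakFactorizationSystem.mk' _ _ fun i p hi hp =>
    hasLiftingProperty_of_trivialCofibration i p hi hp

variable (k) in
/-- The model category structure on the dg-Lie algebras over a `ℚ`-algebra. -/
@[reducible]
def modelCategory [Algebra ℚ k] : ModelCategory (DGLieAlgebra k) :=
  ModelCategory.mk' _

end ModelStructure

end DGLieAlgebra

theorem mainTheorem2 (k : Type u) [CommRing k] [Algebra ℚ k] :
    ∃ _ : ModelCategory (DGLieAlgebra k),
      (∀ (L M : DGLieAlgebra k) (f : L ⟶ M),
        WeakEquivalence f ↔ QuasiIso ((DGLieAlgebra.forgetToComplex k).map f)) ∧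
      (∀ (L M : DGLieAlgebra k) (f : L ⟶ M),
        Fibration f ↔
          ∀ n : ℤ, Function.Surjective
            (((DGLieAlgebra.forgetToComplex k).map f).f n).hom) :=
  ⟨DGLieAlgebra.modelCategory k,
    fun _ _ f => @weakEquivalence_iff _ _ _ _ f (DGLieAlgebra.withWeakEquivalences k),
    fun _ _ f => @fibration_iff _ _ _ _ f (DGLieAlgebra.withFibrations k)⟩
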